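/- For a function $f:\mathbb R\to\mathbb R$ and $m\ge 1$, let $\mathrm{OE}_m(f)$, respectively $\mathrm{UE}_m(f)$, be the random set of $m$ real points whose joint probability density, on $\mathbb R^m$, is a constant times $\prod_{i} f(x_i)\,|\Delta(x)|$, respectively $\prod_i f(x_i)\,\Delta(x)^2$, where $\Delta(x)=\prod_{i<j}(x_j-x_i)$; it is assumed to exist (that is, $f$ is measurable and the expression is, up to a nonzero constant factor, a probability density) whenever it is mentioned. For two such ensembles, $M_1\cup M_2$ denotes the union of independent samples of $M_1$ and $M_2$, and $\mathrm{odd}(M)$ denotes the random set formed by the largest, 3rd largest, 5th largest, $\dots$ points of $M$. Equality of ensembles means equality of the laws of the random sets. Theorem. Fix an integer $n\ge 2$. Let $f:\mathbb R\to\mathbb R$ be differentiable on a possibly unbounded open interval $I\subset\mathbb R$ and $0$ elsewhere, and suppose that $$\mathrm{odd}\bigl(\mathrm{OE}_{n-1}(f)\cup \mathrm{OE}_n(f)\bigr)=\mathrm{UE}_n(g)$$ for some function $g:\mathbb R\to\mathbb R$. Then $g=0$ almost everywhere outside $I$, and either (i) there is $r\in\mathbb R$, with $1/r\notin I$ if $r\neq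 0$, and there are nonzero real constants $a,b$ such that $f(x)=a(1-rx)^{-n}$ for all $x\in I$ and $g(x)=b(1-rx)^{-2n+1}$ for almost every $x\in I$; or (ii) (the case $r=\infty$) $0\notin I$ and there are nonzero real constants $a,b$ such that $f(x)=a\,x^{-n}$ for all $x\in I$ and $g(x)=b\,x^{-2n+1}$ for almost every $x\in I$. -/

import Mathlib

open MeasureTheory

noncomputable section

namespace Decimation

/-- The difference product `Δ(x) = ∏_{i < j} (x_j - x_i)`. -/
def diffProd {n : ℕ} (x : Fin n → ℝ) : ℝ :=
  ∏ i : Fin n, ∏ j ∈ Finset.Ioi i, (x j - x i)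

/-- `μ` is the eigenvalue law with weight `f` and exponent `β` on `n` unordered variables: the
probability measure on `ℝⁿ` whose density is proportional to `∏ i, f (x i) * |Δ(x)| ^ β`.
The constant `c` is the normalisation; no sign is imposed on `f` beyond the density being
nonnegative. -/
structure IsEnsemble (β n : ℕ) (f : ℝ → ℝ) (μ : Measure (Fin n → ℝ)) : Prop where
  isProbabilityMeasure : IsProbabilityMeasure μ
  aemeasurable_weight : AEMeasurable f volume
  exists_density : ∃ c : ℝ,
    (∀ᵐ x : Fin n → ℝ, 0 ≤ c * ((∏ i, f (x i)) * |diffProd x| ^ β)) ∧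
    μ = (volume : Measure (Fin n → ℝ)).withDensity
      (fun x => ENNReal.ofReal (c * ((∏ i, f (x i)) * |diffProd x| ^ β)))

/-- `μ` is the orthogonal ensemble `OE_n(f)`. -/
abbrev IsOE (n : ℕ) (f : ℝ → ℝ) (μ : Measure (Fin n → ℝ)) : Prop := IsEnsemble 1 n f μ

/-- `μ` is the unitary ensemble `UE_n(g)`. -/
abbrev IsUE (n : ℕ) (g : ℝ → ℝ) (μ : Measure (Fin n → ℝ)) : Prop := IsEnsemble 2 n g μ

/-- The rearrangement of a tuple in weakly decreasing order: entry `0` is the largest value,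
entry `1` the second largest, and so on (with multiplicity). -/
def sortDesc {n : ℕ} (x : Fin n → ℝ) : Fin n → ℝ :=
  fun i => x (Tuple.sort x (Fin.rev i))

theorem antitone_sortDesc {n : ℕ} (x : Fin n → ℝ) : Antitone (sortDesc x) := by
  intro i j hij
  exact Tuple.monotone_sort x (Fin.rev_le_rev.mpr hij)

theorem measurable_sortDesc {n : ℕ} :
    Measurable (sortDesc : (Fin n → ℝ) → (Fin n → ℝ)) := by
  have hs : ∀ σ : Equiv.Perm (Fin n), MeasurableSet {x : Fin n → ℝ | Monotone (x ∘ σ)} := by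
    intro σ
    have : {x : Fin n → ℝ | Monotone (x ∘ σ)} =
        ⋂ i, ⋂ j, {x : Fin n → ℝ | i ≤ j → x (σ i) ≤ x (σ j)} := by
      ext x
      simp [Monotone]
    rw [this]
    refine MeasurableSet.iInter fun i => MeasurableSet.iInter fun j => ?_
    by_cases hij : i ≤ j
    · simpa [hij] using
        measurableSet_le (measurable_pi_apply (σ i)) (measurable_pi_apply (σ j))
    · simp [hij]
  intro s hms
  have : sortDesc ⁻¹' s = ⋃ σ : Equiv.Perm (Fin n),
      {x : Fin n → ℝ | Monotone (x ∘ σ)} ∩ (fun x i => x (σ (Fin.rev i))) ⁻¹' s := by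
    ext x
    simp only [Set.mem_preimage, Set.mem_iUnion, Set.mem_inter_iff, Set.mem_ofPred_eq]
    constructor
    · intro hx
      exact ⟨Tuple.sort x, Tuple.monotone_sort x, hx⟩
    · rintro ⟨σ, hσ, hx⟩
      have h := Tuple.comp_sort_eq_comp_iff_monotone.mpr hσ
      have h2 : sortDesc x = fun i => x (σ (Fin.rev i)) := by
        funext i
        exact (congrFun h (Fin.rev i)).symm
      rw [h2]
      exact hx
  rw [this]
  have hm : ∀ σ : Equiv.Perm (Fin n),
      Measurable (fun (x : Fin n → ℝ) (i : Fin n) => x (σ (Fin.rev i))) := fun σ =>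
    measurable_pi_lambda _ fun i => measurable_pi_apply (σ (Fin.rev i))
  exact MeasurableSet.iUnion fun σ => (hs σ).inter (hm σ hms)

/-- The ordered (decreasing) form of the law of `n` unordered points. -/
def orderedLaw {n : ℕ} (μ : Measure (Fin n → ℝ)) : Measure (Fin n → ℝ) :=
  μ.map sortDesc

/-- The random union `M₁ ∪ M₂`: the spectra are drawn independently from `μ` and `ν` and
put together. -/
def superpose {m k : ℕ} (μ : Measure (Fin m → ℝ)) (ν : Measure (Fin k → ℝ)) :
    Measure (Fin (m + k) → ℝ) :=
  (μ.prod ν).map fun p => Fin.append p.1 p.2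

/-- The largest, third largest, fifth largest, ... of `N` points, in decreasing order; there are
`k = (N + 1) / 2` of them (rounded down). -/
def oddPoints {N k : ℕ} (hk : k = (N + 1) / 2) (x : Fin N → ℝ) : Fin k → ℝ :=
  fun i => sortDesc x ⟨2 * (i : ℕ), by have := i.isLt; omega⟩

/-- `odd(M)`, in decreasing order. -/
def oddLaw {N k : ℕ} (hk : k = (N + 1) / 2) (μ : Measure (Fin N → ℝ)) : Measure (Fin k → ℝ) :=
  μ.map (oddPoints hk)

theorem measurable_append {m k : ℕ} :
    Measurable fun p : (Fin m → ℝ) × (Fin k → ℝ) => Fin.append p.1 p.2 := by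
  refine measurable_pi_lambda _ fun i => ?_
  refine Fin.addCases (fun i => ?_) (fun i => ?_) i
  · simpa [Function.comp_def] using (measurable_pi_apply i).comp measurable_fst
  · simpa [Function.comp_def] using (measurable_pi_apply i).comp measurable_snd

theorem measurable_oddPoints {N k : ℕ} (hk : k = (N + 1) / 2) :
    Measurable (oddPoints hk) :=
  measurable_pi_lambda _ fun _ => (measurable_pi_apply _).comp measurable_sortDesc

end Decimation

end

/-!
Write `n = m + 1` and let `F = |f|`. The density of the union of the two orthogonal ensembles at an
ordered configuration `z` of `2 * m + 1` points is `∏ F (z i)` times the sum, over all splittings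
into groups of `m` and `m + 1` points, of the products of the two absolute difference products. That
sum is, up to sign, the Laplace expansion of a matrix whose rows are
`((-1) ^ i * z i ^ k)_{k < m}, (z i ^ k)_{k ≤ m}`; adding columns makes the matrix block triangular,
so the sum is a constant times `Δ(even-indexed points) * Δ(odd-indexed points)`
(`exists_sum_abs_diffProd`).

Given the odd points `x`, the remaining points interlace with them, and integrating these out gives
a determinant: up to constants, the density of the odd points is
`∏ F (x i) * Δ(x) * det (1, F_0, …, F_{m-1})(x i)`, where `F_j` is a primitive of `t ↦ F t * t ^ j`.
The hypothesis therefore says (`functional_equation`) that, for almost every `x`,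
`K * ∏ F (x i) * det (1, F_0, …, F_{m-1})(x i) = c * ∏ g (x i) * Δ(x)`.

Both sides are determinants, so moving a single point and using Cramer's rule shows that
`F • (1, F_0, …, F_{m-1})` and `g • (1, s, …, s ^ m)` differ by a constant invertible matrix
(`exists_polynomial_relation`). In particular `F = g * p` for a polynomial `p`, and where `F` is
nonzero each monomial `s ^ k`, `k ≤ m`, is `p` times a combination of `1, F_0, …, F_{m-1}`.
Differentiating gives `k * s ^ (k - 1) * p = p' * s ^ k + p ^ 2 * F * q_k` with `q_k` of degree less
than `m`. The cases `k = 0, 1` give `p = p ^ 2 * F * σ` with `σ = q_1 - X * q_0`, and then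
`q_k = k * X ^ (k - 1) * σ + X ^ k * q_0` for every `k`. The degree bounds for `k = m - 1, m` force
`σ` to be affine and `q_0` to be `-m * σ'`, whence `p' * σ = m * σ' * p`, so `p` is a multiple of
`σ ^ m`, `F` of `σ ^ (-n)` and `g = F / p` of `σ ^ (-2 * n + 1)` (`rational_form`).

These formulas hold where `F` is nonzero, with the same `σ` throughout; by continuity `F` cannot
reach `0` inside `I` (`eq_one_of_isPreconnected`). The two alternatives of the theorem are
`σ = α * (1 - r * x)` and `σ = β * x`.
-/

namespace Decimation

open Equiv Matrix Finset

/-! ### Summing products of two difference products over all splittings -/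

lemma diffProd_eq_det {n : ℕ} (x : Fin n → ℝ) : diffProd x = (vandermonde x).det :=
  (det_vandermonde x).symm

/-- The square matrix whose row at `a` lists the powers `w a ^ i` for `i < m`, each multiplied by
`e a`, followed by the unweighted powers `w a ^ j` for `j < k`. Its Laplace expansion along the two
groups of columns is a signed sum of products of two difference products. -/
def laplaceMatrix {m k : ℕ} (e w : Fin m ⊕ Fin k → ℝ) :
    Matrix (Fin m ⊕ Fin k) (Fin m ⊕ Fin k) ℝ :=
  Matrix.of fun a c =>
    Sum.elim (fun i : Fin m => e a * w a ^ (i : ℕ)) (fun j : Fin k => w a ^ (j : ℕ)) c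

/-- Laplace expansion of `laplaceMatrix`, written as a sum over all permutations instead of over
subsets of rows; the factorials count the permutations that give the same subset. -/
lemma sum_sign_mul_diffProd_mul_diffProd (m k : ℕ) (e w : Fin m ⊕ Fin k → ℝ) :
    ∑ π : Perm (Fin m ⊕ Fin k), ((Perm.sign π : ℤ) : ℝ) * ((∏ i, e (π (Sum.inl i))) *
      (diffProd (fun i => w (π (Sum.inl i))) * diffProd (fun j => w (π (Sum.inr j))))) =
    (m.factorial * k.factorial : ℝ) * (laplaceMatrix e w).det := by
  have h1 : ∀ π : Perm (Fin m ⊕ Fin k), ((Perm.sign π : ℤ) : ℝ) * ((∏ i, e (π (Sum.inl i))) *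
      (diffProd (fun i => w (π (Sum.inl i))) * diffProd (fun j => w (π (Sum.inr j))))) =
      ∑ α : Perm (Fin m), ∑ β : Perm (Fin k),
        ((Perm.sign (π * Perm.sumCongr α β) : ℤ) : ℝ) *
        ∏ c, laplaceMatrix e w ((π * Perm.sumCongr α β) c) c := by
    intro π
    rw [diffProd_eq_det, diffProd_eq_det, det_apply', det_apply', Finset.sum_mul_sum,
      Finset.mul_sum, Finset.mul_sum]
    refine Finset.sum_congr rfl fun α _ => ?_
    rw [Finset.mul_sum, Finset.mul_sum]
    refine Finset.sum_congr rfl fun β _ => ?_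
    have hα : ∏ i, e (π (Sum.inl i)) = ∏ i, e (π (Sum.inl (α i))) :=
      (Equiv.prod_comp α (fun i => e (π (Sum.inl i)))).symm
    rw [hα]
    simp only [vandermonde_apply, Perm.sign_mul, Perm.sign_sumCongr, Fintype.prod_sum_type,
      laplaceMatrix, Matrix.of_apply, Sum.elim_inl, Sum.elim_inr, Perm.mul_apply,
      Perm.sumCongr_apply,
      Sum.map_inl, Sum.map_inr, Finset.prod_mul_distrib]
    push_cast
    ring
  simp_rw [h1]
  rw [Finset.sum_comm]
  have h2 : ∀ (α : Perm (Fin m)) (β : Perm (Fin k)), ∑ π : Perm (Fin m ⊕ Fin k),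
        ((Perm.sign (π * Perm.sumCongr α β) : ℤ) : ℝ) *
        ∏ c, laplaceMatrix e w ((π * Perm.sumCongr α β) c) c = (laplaceMatrix e w).det := by
    intro α β
    rw [det_apply']
    exact Equiv.sum_comp (Equiv.mulRight (Perm.sumCongr α β)) (fun π : Perm (Fin m ⊕ Fin k) =>
        ((Perm.sign π : ℤ) : ℝ) * ∏ c, laplaceMatrix e w (π c) c)
  have h3 : ∀ α : Perm (Fin m), ∑ π : Perm (Fin m ⊕ Fin k), ∑ β : Perm (Fin k),
        ((Perm.sign (π * Perm.sumCongr α β) : ℤ) : ℝ) *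
        ∏ c, laplaceMatrix e w ((π * Perm.sumCongr α β) c) c =
          (k.factorial : ℝ) * (laplaceMatrix e w).det := by
    intro α
    rw [Finset.sum_comm]
    simp_rw [h2]
    simp [Fintype.card_perm]
  simp_rw [h3]
  simp [Fintype.card_perm, mul_assoc]

/-- The weight `-1` on the first block and `1` on the second. Under `interleave` it is the sign
`(-1) ^ k` of the position `k` of a point in the ordered union. -/
def blockSign {m k : ℕ} : Fin m ⊕ Fin k → ℝ := Sum.elim (fun _ => -1) (fun _ => 1)

/-- With alternating weights, subtracting columns makes `laplaceMatrix` block triangular, with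
Vandermonde matrices on the diagonal. -/
lemma det_blockSign (m : ℕ) (w : Fin m ⊕ Fin (m + 1) → ℝ) :
    (laplaceMatrix blockSign w).det =
      (-2) ^ m * (diffProd (fun i => w (Sum.inl i)) * diffProd (fun j => w (Sum.inr j))) := by
  set E : Matrix (Fin m ⊕ Fin (m + 1)) (Fin m ⊕ Fin (m + 1)) ℝ :=
    fromBlocks 1 0 (Matrix.of fun (k : Fin (m + 1)) (c : Fin m) =>
      if k = c.castSucc then (-1 : ℝ) else 0) 1 with hE
  have hdetE : E.det = 1 := by simp [hE]
  have key : (laplaceMatrix blockSign w) * E =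
      fromBlocks ((-2 : ℝ) • vandermonde (fun i => w (Sum.inl i)))
        (Matrix.of fun (i : Fin m) (j : Fin (m + 1)) => w (Sum.inl i) ^ (j : ℕ)) 0
        (vandermonde (fun j => w (Sum.inr j))) := by
    ext a c
    rcases a with a | a <;> rcases c with c | c <;>
      (simp [laplaceMatrix, Matrix.mul_apply, Fintype.sum_sum_type, hE, blockSign,
        vandermonde_apply, Matrix.one_apply]; try ring)
  have := congrArg Matrix.det key
  rw [det_mul, hdetE, mul_one, det_fromBlocks_zero₂₁, det_smul, Fintype.card_fin,
    ← diffProd_eq_det, ← diffProd_eq_det] at this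
  rw [this, mul_assoc]

/-- `1` if an injective tuple has an even number of inversions and `-1` if it has an odd number. -/
def orderSign {m N : ℕ} (a : Fin m → Fin N) : ℝ :=
  ∏ i, ∏ j ∈ Finset.Ioi i, if a i < a j then 1 else -1

lemma abs_diffProd {m N : ℕ} {z : Fin N → ℝ} (hz : StrictMono z) (a : Fin m → Fin N) :
    |diffProd (fun i => z (a i))| = orderSign a * diffProd (fun i => z (a i)) := by
  simp only [diffProd, orderSign, Finset.abs_prod, ← Finset.prod_mul_distrib]
  refine Finset.prod_congr rfl fun i _ => Finset.prod_congr rfl fun j _ => ?_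
  split_ifs with h
  · rw [one_mul, abs_of_pos (sub_pos.2 (hz h))]
  · rw [abs_of_nonpos (sub_nonpos.2 (hz.monotone (not_lt.1 h)))]; ring

/-- Among the two orders of a pair of distinct indices exactly one contributes `-1`, so the product
does not depend on the injective tuple `a`. -/
lemma prod_ite_le {m N : ℕ} {a : Fin m → Fin N} (ha : Function.Injective a) :
    ∏ i, ∏ j, (if a i ≤ a j then (1 : ℝ) else -1) = ∏ i : Fin m, ∏ _j ∈ Finset.Ioi i, (-1 : ℝ) := by
  have h := Finset.prod_prod_Ioi_mul_eq_prod_prod_off_diag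
    (fun j i : Fin m => if a i ≤ a j then (1 : ℝ) else -1)
  trans ∏ i, ∏ j ∈ {i}ᶜ, (if a i ≤ a j then (1 : ℝ) else -1)
  · refine Finset.prod_congr rfl fun i _ => ?_
    rw [← Finset.mul_prod_erase univ _ (Finset.mem_univ i)]
    simp [Finset.compl_singleton, Finset.erase_eq]
  · rw [← h]
    refine Finset.prod_congr rfl fun i _ => Finset.prod_congr rfl fun j hj => ?_
    have hne : a i ≠ a j := fun h => (Finset.mem_Ioi.1 hj).ne (ha h)
    rcases lt_or_gt_of_ne hne with h | h
    · simp [h.le, h]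
    · simp [h.le, h]

lemma prod_Ioi_eq {m : ℕ} (F : Fin m → Fin m → ℝ) :
    ∏ i, ∏ j ∈ Finset.Ioi i, F i j = ∏ i, ∏ j, if i < j then F i j else 1 := by
  refine Finset.prod_congr rfl fun i _ => ?_
  rw [← Finset.prod_filter]
  congr 1
  ext j; simp

lemma prod_ite_le_fin {N : ℕ} (a : Fin N) :
    ∏ k : Fin N, (if a ≤ k then (1 : ℝ) else -1) = (-1) ^ (a : ℕ) := by
  rw [Finset.prod_ite]
  simp only [Finset.prod_const_one, one_mul, Finset.prod_const]
  congr 1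
  have : (univ.filter fun k : Fin N => ¬ a ≤ k) = Finset.Iio a := by ext; simp
  rw [this, Fin.card_Iio]

/-- When the points of two groups are arranged by `τ ∘ π`, the product of the inversion signs inside
the groups is the sign of `π` times the product of `(-1) ^ position` over the first group, up to a
sign `ε` that does not depend on `π`. The inversions between the groups account for the
positions. -/
lemma orderSign_mul_orderSign {m k : ℕ} (τ : Fin m ⊕ Fin k ≃ Fin (m + k)) :
    ∃ ε : ℝ, ε * ε = 1 ∧ ∀ π : Perm (Fin m ⊕ Fin k),
      orderSign (fun i => τ (π (Sum.inl i))) * orderSign (fun j => τ (π (Sum.inr j))) =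
        ε * (((Perm.sign π : ℤ) : ℝ) * ∏ i, (-1 : ℝ) ^ (τ (π (Sum.inl i)) : ℕ)) := by
  set s₀ : ℝ := ((Perm.sign (finSumFinEquiv.symm.trans τ : Perm (Fin (m + k))) : ℤ) : ℝ)
  set t₀ : ℝ := ∏ i : Fin m, ∏ _j ∈ Finset.Ioi i, (-1 : ℝ)
  have hs₀ : s₀ * s₀ = 1 := by
    simp only [s₀, ← Int.cast_mul, ← Units.val_mul, Int.units_mul_self]; simp
  have ht₀ : t₀ * t₀ = 1 := by
    simp only [t₀, ← Finset.prod_mul_distrib]; simp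
  refine ⟨s₀ * t₀, by linear_combination (t₀ * t₀) * hs₀ + ht₀, fun π => ?_⟩
  set σ : Fin m ⊕ Fin k → Fin (m + k) := fun a => τ (π a) with hσ
  have hσb : Function.Bijective σ := τ.bijective.comp π.bijective
  set cr : ℝ := ∏ i : Fin m, ∏ j : Fin k,
    (if σ (Sum.inl i) < σ (Sum.inr j) then (1 : ℝ) else -1) with hcr
  -- the sign of the whole arrangement factors into the two blocks and the cross terms
  have hsign : s₀ * ((Perm.sign π : ℤ) : ℝ) =
      orderSign (fun i => σ (Sum.inl i)) * cr * orderSign (fun j => σ (Sum.inr j)) := by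
    have h1 : s₀ * ((Perm.sign π : ℤ) : ℝ) =
        ((Perm.sign (finSumFinEquiv.symm.trans (π.trans τ) : Perm (Fin (m + k))) : ℤ) : ℝ) := by
      have : (finSumFinEquiv.symm.trans (π.trans τ) : Perm (Fin (m + k))) =
          (finSumFinEquiv.symm.trans τ : Perm (Fin (m + k))) * finSumFinEquiv.permCongr π := by
        ext x; simp
      rw [this, Perm.sign_mul, Perm.sign_permCongr]
      simp [s₀]
    rw [h1, Perm.sign_eq_prod_prod_Ioi]
    push_cast
    have h2 : ∀ x y : Fin (m + k), (((if ((finSumFinEquiv.symm.trans (π.trans τ)) x) <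
        ((finSumFinEquiv.symm.trans (π.trans τ)) y) then (1 : ℤˣ) else -1 : ℤˣ) : ℤ) : ℝ) =
        if σ (finSumFinEquiv.symm x) < σ (finSumFinEquiv.symm y) then 1 else -1 := by
      intro x y
      change (((if σ (finSumFinEquiv.symm x) < σ (finSumFinEquiv.symm y) then (1 : ℤˣ)
        else -1 : ℤˣ) : ℤ) : ℝ) = _
      split_ifs <;> simp
    simp_rw [h2]
    have h3 : ∀ (i : Fin m) (j : Fin k), Fin.castAdd k i < Fin.natAdd m j := fun i j => by
      rw [Fin.lt_def]; simp; omega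
    have h3' : ∀ (i : Fin m) (j : Fin k), ¬ (Fin.natAdd m j < Fin.castAdd k i) := fun i j =>
      not_lt.2 (h3 i j).le
    have h6 : ∀ (i j : Fin m), Fin.castAdd k i < Fin.castAdd k j ↔ i < j := fun i j => Iff.rfl
    simp only [orderSign]
    rw [prod_Ioi_eq, prod_Ioi_eq, prod_Ioi_eq, Fin.prod_univ_add]
    simp only [Fin.prod_univ_add, finSumFinEquiv_symm_apply_castAdd,
      finSumFinEquiv_symm_apply_natAdd, h3, h3', h6, Fin.natAdd_lt_natAdd_iff, if_true, if_false,
      Finset.prod_mul_distrib, Finset.prod_const_one, one_mul, hcr]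
  -- the positions of all points below `σ (inl i)`, minus those taken by the first block
  have hcross : cr = (∏ i, (-1 : ℝ) ^ (σ (Sum.inl i) : ℕ)) * t₀ := by
    have h4 : ∀ i : Fin m, (∏ j : Fin m, (if σ (Sum.inl i) ≤ σ (Sum.inl j) then (1 : ℝ) else -1)) *
        ∏ j : Fin k, (if σ (Sum.inl i) < σ (Sum.inr j) then (1 : ℝ) else -1) =
        (-1 : ℝ) ^ (σ (Sum.inl i) : ℕ) := by
      intro i
      rw [← prod_ite_le_fin, ← Equiv.prod_comp (Equiv.ofBijective σ hσb), Fintype.prod_sum_type]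
      congr 1
      refine Finset.prod_congr rfl fun j _ => ?_
      have hne : σ (Sum.inl i) ≠ σ (Sum.inr j) := fun h => by simpa using hσb.1 h
      simp [hne.le_iff_lt]
    have h5 := Finset.prod_congr (rfl : (univ : Finset (Fin m)) = univ) fun i _ => h4 i
    have h7 := prod_ite_le (a := fun i : Fin m => σ (Sum.inl i)) (hσb.1.comp Sum.inl_injective)
    rw [Finset.prod_mul_distrib, h7] at h5
    rw [← h5]
    change cr = t₀ * cr * t₀
    linear_combination -cr * ht₀
  have hcc : cr * cr = 1 := by
    simp only [hcr, ← Finset.prod_mul_distrib]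
    refine Finset.prod_eq_one fun i _ => Finset.prod_eq_one fun j _ => ?_
    split_ifs <;> norm_num
  change orderSign (fun i => σ (Sum.inl i)) * orderSign (fun j => σ (Sum.inr j)) = _ 
  have : (∏ i, (-1 : ℝ) ^ (σ (Sum.inl i) : ℕ)) = cr * t₀ := by
    rw [hcross]; linear_combination -(∏ i, (-1 : ℝ) ^ (σ (Sum.inl i) : ℕ)) * ht₀
  change _ = s₀ * t₀ * (((Perm.sign π : ℤ) : ℝ) * ∏ i, (-1 : ℝ) ^ (σ (Sum.inl i) : ℕ))
  rw [this]
  linear_combination (-(t₀ * t₀ * cr)) * hsign -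
    (orderSign (fun i => σ (Sum.inl i)) * orderSign (fun j => σ (Sum.inr j))) *
      (hcc * (t₀ * t₀) + ht₀)

/-- The positions of two interlacing tuples in their ordered union: the `m` points of the first
block take the odd positions, the `m + 1` points of the second block the even positions, counted
from `0`. -/
def interleave (m : ℕ) : Fin m ⊕ Fin (m + 1) ≃ Fin (m + (m + 1)) where
  toFun := Sum.elim (fun i => ⟨2 * i + 1, by omega⟩) (fun j => ⟨2 * j, by omega⟩)
  invFun k := if h : (k : ℕ) % 2 = 1 then Sum.inl ⟨k / 2, by omega⟩ else Sum.inr ⟨k / 2, by omega⟩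
  left_inv := by
    rintro (i | j)
    · have : (2 * (i : ℕ) + 1) / 2 = i := by omega
      simp [this]
    · simp
  right_inv k := by
    dsimp only
    split_ifs with h
    · ext; simp; omega
    · ext; simp; omega

lemma strictMono_interleave_inl (m : ℕ) : StrictMono fun i => interleave m (Sum.inl i) := by
  intro i j h
  rw [Fin.lt_def] at *
  simp [interleave]; omega

lemma strictMono_interleave_inr (m : ℕ) : StrictMono fun j => interleave m (Sum.inr j) := by
  intro i j h
  rw [Fin.lt_def] at *
  simp [interleave]; omega

lemma diffProd_pos {n : ℕ} {x : Fin n → ℝ} (hx : StrictMono x) : 0 < diffProd x :=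
  Finset.prod_pos fun _ _ => Finset.prod_pos fun _ hj => sub_pos.2 (hx (Finset.mem_Ioi.1 hj))

/-- Summed over all ways to distribute `2 * m + 1` ordered points over groups of sizes `m` and
`m + 1`, the product of the absolute difference products of the groups is a constant multiple of
the product for the alternating distribution. -/
lemma exists_sum_abs_diffProd (m : ℕ) : ∃ K : ℝ, 0 ≤ K ∧
    ∀ z : Fin (m + (m + 1)) → ℝ, StrictMono z → ∑ π : Perm (Fin m ⊕ Fin (m + 1)),
      |diffProd (fun i => z (interleave m (π (Sum.inl i))))| *
      |diffProd (fun j => z (interleave m (π (Sum.inr j))))| =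
    K * (diffProd (fun i => z (interleave m (Sum.inl i))) *
      diffProd (fun j => z (interleave m (Sum.inr j)))) := by
  obtain ⟨ε, -, hε⟩ := orderSign_mul_orderSign (interleave m)
  have main : ∀ z : Fin (m + (m + 1)) → ℝ, StrictMono z →
    ∑ π : Perm (Fin m ⊕ Fin (m + 1)),
      |diffProd (fun i => z (interleave m (π (Sum.inl i))))| *
      |diffProd (fun j => z (interleave m (π (Sum.inr j))))| =
    (ε * (m.factorial * (m + 1).factorial) * (-2) ^ m) *
      (diffProd (fun i => z (interleave m (Sum.inl i))) *
      diffProd (fun j => z (interleave m (Sum.inr j)))) := by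
    intro z hz
    have hb : ∀ a : Fin m ⊕ Fin (m + 1), (-1 : ℝ) ^ (interleave m a : ℕ) = blockSign a := by
      rintro (i | j) <;> simp [interleave, blockSign, pow_succ, pow_mul]
    have h := sum_sign_mul_diffProd_mul_diffProd m (m + 1) blockSign (fun a => z (interleave m a))
    rw [det_blockSign] at h
    calc _ = ∑ π : Perm (Fin m ⊕ Fin (m + 1)), ε * (((Perm.sign π : ℤ) : ℝ) *
          ((∏ i, blockSign (π (Sum.inl i))) *
        (diffProd (fun i => z (interleave m (π (Sum.inl i)))) *
          diffProd (fun j => z (interleave m (π (Sum.inr j))))))) := by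
          refine Finset.sum_congr rfl fun π _ => ?_
          rw [abs_diffProd hz, abs_diffProd hz]
          have := hε π
          simp only [hb] at this
          linear_combination (diffProd (fun i => z (interleave m (π (Sum.inl i)))) *
            diffProd (fun j => z (interleave m (π (Sum.inr j))))) * this
      _ = _ := by
          rw [← Finset.mul_sum, h]; ring
  refine ⟨ε * (m.factorial * (m + 1).factorial) * (-2) ^ m, ?_, main⟩
  have hz₀ : StrictMono fun k : Fin (m + (m + 1)) => ((k : ℕ) : ℝ) := fun a b h =>
    Nat.cast_lt.2 h
  have h1 := main _ hz₀
  refine nonneg_of_mul_nonneg_left (b := diffProd (fun i : Fin m =>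
    ((interleave m (Sum.inl i) : ℕ) : ℝ)) * diffProd (fun j : Fin (m + 1) =>
    ((interleave m (Sum.inr j) : ℕ) : ℝ))) ?_ (mul_pos ?_ ?_)
  · rw [← h1]
    exact Finset.sum_nonneg fun π _ => mul_nonneg (abs_nonneg _) (abs_nonneg _)
  · exact diffProd_pos (hz₀.comp (strictMono_interleave_inl m))
  · exact diffProd_pos (hz₀.comp (strictMono_interleave_inr m))

end Decimation

namespace Decimation

open Equiv Set ENNReal

/-! ### Laws of ordered points -/

lemma measurableSet_strictMono (N : ℕ) : MeasurableSet {z : Fin N → ℝ | StrictMono z} := by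
  have : {z : Fin N → ℝ | StrictMono z} = ⋂ i, ⋂ j, {z : Fin N → ℝ | i < j → z i < z j} := by
    ext z; simp [StrictMono]
  rw [this]
  refine MeasurableSet.iInter fun i => MeasurableSet.iInter fun j => ?_
  by_cases h : i < j
  · simpa [h] using measurableSet_lt (measurable_pi_apply i) (measurable_pi_apply j)
  · simp [h]

lemma ae_injective (ι : Type*) [Fintype ι] : ∀ᵐ w : ι → ℝ, Function.Injective w := by
  classical
  have h : ∀ i j : ι, i ≠ j → ∀ᵐ w : ι → ℝ, w i ≠ w j := by
    intro i j hij
    let s : Submodule ℝ (ι → ℝ) :=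
      LinearMap.ker ((LinearMap.proj i : (ι → ℝ) →ₗ[ℝ] ℝ) - LinearMap.proj j)
    have hs : s ≠ ⊤ := by
      intro htop
      have : (Pi.single i 1 : ι → ℝ) ∈ s := htop ▸ Submodule.mem_top
      simp [s, LinearMap.mem_ker, hij] at this
    have := Measure.addHaar_submodule (volume : Measure (ι → ℝ)) s hs
    rw [ae_iff]
    convert! this using 2
    ext w
    simp [s, LinearMap.mem_ker, sub_eq_zero]
  have h2 : ∀ᵐ w : ι → ℝ, ∀ i j : ι, i ≠ j → w i ≠ w j := by
    rw [ae_all_iff]; intro i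
    rw [ae_all_iff]; intro j
    by_cases hij : i = j
    · simp [hij]
    · simpa [hij] using h i j hij
  filter_upwards [h2] with w hw i j hij
  by_contra hne
  exact hw i j hne hij

lemma measurePreserving_comp_equiv {ι κ : Type*} [Fintype ι] [Fintype κ] (σ : ι ≃ κ) :
    MeasurePreserving (fun z : κ → ℝ => fun a => z (σ a)) volume volume :=
  volume_preserving_arrowCongr' σ.symm (MeasurableEquiv.refl ℝ) (MeasurePreserving.id volume)

lemma exists_equiv_strictMono {ι : Type*} [Fintype ι] {N : ℕ} (e : ι ≃ Fin N) {w : ι → ℝ}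
    (hw : Function.Injective w) : ∃ σ : ι ≃ Fin N, StrictMono fun k => w (σ.symm k) := by
  refine ⟨e.trans (Tuple.sort (w ∘ e.symm)).symm, ?_⟩
  exact (Tuple.monotone_sort (w ∘ e.symm)).strictMono_of_injective
    ((hw.comp e.symm.injective).comp (Equiv.injective _))

/-- An integral over all tuples is a sum, over the possible orders of the coordinates, of integrals
over increasing tuples. -/
lemma lintegral_eq_sum_strictMono {ι : Type*} [Fintype ι] [DecidableEq ι] {N : ℕ}
    (e : ι ≃ Fin N) {H : (ι → ℝ) → ℝ≥0∞} (hH : Measurable H) :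
    ∫⁻ w, H w = ∑ σ : ι ≃ Fin N, ∫⁻ z in {z : Fin N → ℝ | StrictMono z}, H fun a => z (σ a) := by
  let S : (ι ≃ Fin N) → Set (ι → ℝ) := fun σ => {w | StrictMono fun k => w (σ.symm k)}
  have hSm : ∀ σ, MeasurableSet (S σ) := fun σ =>
    (measurePreserving_comp_equiv σ.symm).measurable (measurableSet_strictMono N)
  have hdisj : Pairwise (Function.onFun Disjoint S) := by
    intro σ τ hne
    refine Set.disjoint_left.2 fun w hσ hτ => hne ?_
    have hr : Set.range (fun k => w (σ.symm k)) = Set.range (fun k => w (τ.symm k)) := by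
      rw [← Function.comp_def w, ← Function.comp_def w, Set.range_comp, Set.range_comp,
        σ.symm.range_eq_univ, τ.symm.range_eq_univ]
    have heq := (StrictMono.range_inj hσ hτ).1 hr
    have hinj : Function.Injective w := by
      intro a b hab
      have := StrictMono.injective (f := fun k => w (σ.symm k)) hσ
        (a₁ := σ a) (a₂ := σ b) (by simpa using hab)
      exact σ.injective this
    have h3 : σ.symm = τ.symm := by
      ext k
      exact hinj (congrFun heq k)
    simpa using congrArg Equiv.symm h3
  have hU : (⋃ σ, S σ) =ᵐ[volume] (Set.univ : Set (ι → ℝ)) := by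
    rw [Filter.eventuallyEq_univ]
    filter_upwards [ae_injective ι] with w hw
    obtain ⟨σ, hσ⟩ := exists_equiv_strictMono e hw
    exact Set.mem_iUnion.2 ⟨σ, hσ⟩
  rw [← setLIntegral_univ, ← setLIntegral_congr hU, lintegral_iUnion hSm hdisj, tsum_fintype]
  refine Finset.sum_congr rfl fun σ _ => ?_
  rw [← (measurePreserving_comp_equiv σ).setLIntegral_comp_preimage (hSm σ) hH]
  congr 2
  ext z
  simp [S]

lemma sortDesc_of_strictMono {N : ℕ} {z : Fin N → ℝ} (hz : StrictMono z) (σ : Perm (Fin N)) :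
    sortDesc (fun i => z (σ i)) = fun i => z (Fin.rev i) := by
  set x : Fin N → ℝ := fun i => z (σ i) with hx
  have h1 : StrictMono (x ∘ Tuple.sort x) :=
    (Tuple.monotone_sort x).strictMono_of_injective
      ((hz.injective.comp σ.injective).comp (Equiv.injective _))
  have h2 : x ∘ Tuple.sort x = z := by
    refine (StrictMono.range_inj h1 hz).1 ?_
    rw [Set.range_comp, (Tuple.sort x).range_eq_univ, Set.image_univ]
    exact σ.surjective.range_comp z
  funext i
  exact congrFun h2 (Fin.rev i)

lemma lintegral_orderedLaw {n : ℕ} {d : (Fin n → ℝ) → ℝ≥0∞} (hd : Measurable d)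
    (hsymm : ∀ (σ : Perm (Fin n)) x, d (fun i => x (σ i)) = d x)
    {φ : (Fin n → ℝ) → ℝ≥0∞} (hφ : Measurable φ) :
    ∫⁻ x, φ x ∂(orderedLaw (volume.withDensity d)) =
      n.factorial * ∫⁻ z in {z : Fin n → ℝ | StrictMono z}, φ (fun i => z (Fin.rev i)) * d z := by
  have hφs : Measurable fun x : Fin n → ℝ => φ (sortDesc x) := hφ.comp measurable_sortDesc
  rw [orderedLaw, lintegral_map hφ measurable_sortDesc,
    lintegral_withDensity_eq_lintegral_mul _ hd hφs,
    lintegral_eq_sum_strictMono (Equiv.refl _) (hd.mul hφs)]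
  rw [Finset.sum_congr rfl (g := fun _ => ∫⁻ z in {z : Fin n → ℝ | StrictMono z},
    φ (fun i => z (Fin.rev i)) * d z)]
  · simp [Fintype.card_perm]
  · intro σ _
    refine setLIntegral_congr_fun (measurableSet_strictMono n) fun z hz => ?_
    simp only [Pi.mul_apply]
    rw [sortDesc_of_strictMono hz, hsymm, mul_comm]

lemma lintegral_oddLaw_superpose {m : ℕ} (hk : m + 1 = (m + (m + 1) + 1) / 2)
    {d₁ : (Fin m → ℝ) → ℝ≥0∞} {d₂ : (Fin (m + 1) → ℝ) → ℝ≥0∞}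
    (hd₁ : Measurable d₁) (hd₂ : Measurable d₂) {φ : (Fin (m + 1) → ℝ) → ℝ≥0∞}
    (hφ : Measurable φ) :
    ∫⁻ x, φ x ∂(oddLaw hk (superpose (volume.withDensity d₁) (volume.withDensity d₂))) =
      ∫⁻ z in {z : Fin (m + (m + 1)) → ℝ | StrictMono z},
        φ (fun i => z (interleave m (Sum.inr (Fin.rev i)))) *
        ∑ π : Perm (Fin m ⊕ Fin (m + 1)), d₁ (fun i => z (interleave m (π (Sum.inl i)))) *
          d₂ (fun j => z (interleave m (π (Sum.inr j)))) := by
  have hφo : Measurable fun x => φ (oddPoints hk x) := hφ.comp (measurable_oddPoints hk)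
  have hdd : Measurable fun p : (Fin m → ℝ) × (Fin (m + 1) → ℝ) => d₁ p.1 * d₂ p.2 :=
    (hd₁.comp measurable_fst).mul (hd₂.comp measurable_snd)
  have hφa : Measurable fun p : (Fin m → ℝ) × (Fin (m + 1) → ℝ) =>
      φ (oddPoints hk (Fin.append p.1 p.2)) := hφo.comp measurable_append
  have hG : Measurable fun p : (Fin m → ℝ) × (Fin (m + 1) → ℝ) =>
      d₁ p.1 * d₂ p.2 * φ (oddPoints hk (Fin.append p.1 p.2)) :=
    hdd.mul hφa
  have hsp := volume_measurePreserving_sumPiEquivProdPi (fun _ : Fin m ⊕ Fin (m + 1) => ℝ)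
  have hsm : Measurable fun w : Fin m ⊕ Fin (m + 1) → ℝ =>
      ((fun i => w (Sum.inl i), fun j => w (Sum.inr j)) : (Fin m → ℝ) × (Fin (m + 1) → ℝ)) :=
    hsp.measurable
  have h1 : ∫⁻ x, φ x ∂(oddLaw hk (superpose (volume.withDensity d₁) (volume.withDensity d₂))) =
      ∫⁻ w : Fin m ⊕ Fin (m + 1) → ℝ, d₁ (fun i => w (Sum.inl i)) * d₂ (fun j => w (Sum.inr j)) *
        φ (oddPoints hk (Fin.append (fun i => w (Sum.inl i)) (fun j => w (Sum.inr j)))) := by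
    rw [oddLaw, superpose, lintegral_map hφ (measurable_oddPoints hk),
      lintegral_map hφo measurable_append, prod_withDensity hd₁ hd₂,
      lintegral_withDensity_eq_lintegral_mul _
        hdd hφa]
    exact (hsp.lintegral_comp hG).symm
  have hGw : Measurable fun w : Fin m ⊕ Fin (m + 1) → ℝ =>
      d₁ (fun i => w (Sum.inl i)) * d₂ (fun j => w (Sum.inr j)) *
        φ (oddPoints hk (Fin.append (fun i => w (Sum.inl i)) (fun j => w (Sum.inr j)))) :=
    hG.comp hsm
  rw [h1, lintegral_eq_sum_strictMono (interleave m) hGw]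
  have hmeas : ∀ σ : Fin m ⊕ Fin (m + 1) ≃ Fin (m + (m + 1)),
      Measurable fun z : Fin (m + (m + 1)) → ℝ => d₁ (fun i => z (σ (Sum.inl i))) *
        d₂ (fun j => z (σ (Sum.inr j))) := by
    intro σ
    exact (hd₁.comp (measurable_pi_lambda _ fun i => measurable_pi_apply _)).mul
      (hd₂.comp (measurable_pi_lambda _ fun i => measurable_pi_apply _))
  have hφr : Measurable fun z : Fin (m + (m + 1)) → ℝ =>
      φ (fun i => z (interleave m (Sum.inr (Fin.rev i)))) :=
    hφ.comp (measurable_pi_lambda _ fun i => measurable_pi_apply _)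
  -- relabel the bijections by permutations of the index set
  let Q : Perm (Fin m ⊕ Fin (m + 1)) ≃ (Fin m ⊕ Fin (m + 1) ≃ Fin (m + (m + 1))) :=
    { toFun := fun π => π.trans (interleave m)
      invFun := fun σ => σ.trans (interleave m).symm
      left_inv := fun π => by ext a; simp
      right_inv := fun σ => by ext a; simp }
  rw [← Q.sum_comp]
  simp_rw [Finset.mul_sum]
  have hterm : ∀ π : Perm (Fin m ⊕ Fin (m + 1)), Measurable fun z : Fin (m + (m + 1)) → ℝ =>
      φ (fun i => z (interleave m (Sum.inr (Fin.rev i)))) *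
        (d₁ (fun i => z (interleave m (π (Sum.inl i)))) *
          d₂ (fun j => z (interleave m (π (Sum.inr j))))) := fun π => hφr.mul (hmeas (Q π))
  rw [lintegral_finsetSum _ fun π _ => hterm π]
  refine Finset.sum_congr rfl fun π _ => ?_
  refine setLIntegral_congr_fun (measurableSet_strictMono _) fun z hz => ?_
  rw [mul_comm]
  congr 2
  have happ : Fin.append (fun i => z (Q π (Sum.inl i))) (fun j => z (Q π (Sum.inr j))) =
      fun k => z ((finSumFinEquiv.symm.trans (Q π) : Perm (Fin (m + (m + 1)))) k) := by
    funext k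
    refine Fin.addCases (fun i => ?_) (fun j => ?_) k <;> simp
  funext i
  rw [happ, oddPoints, sortDesc_of_strictMono hz]
  refine congrArg z (Fin.ext ?_)
  simp [interleave]
  omega

/-- The open box of tuples interlacing with `x`. -/
def interlacingBox {m : ℕ} (x : Fin (m + 1) → ℝ) : Set (Fin m → ℝ) :=
  Set.univ.pi fun i => Set.Ioo (x i.castSucc) (x i.succ)

lemma strictMono_iff_interlacing {m : ℕ} (z : Fin (m + (m + 1)) → ℝ) :
    StrictMono z ↔ StrictMono (fun j => z (interleave m (Sum.inr j))) ∧
      (fun i => z (interleave m (Sum.inl i))) ∈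
        interlacingBox fun j => z (interleave m (Sum.inr j)) := by
  constructor
  · intro h
    refine ⟨fun i j hij => h ?_, fun i _ => ⟨h ?_, h ?_⟩⟩ <;> rw [Fin.lt_def] at * <;>
      simp [interleave] at * <;> omega
  · rintro ⟨-, h⟩
    refine (Fin.strictMono_iff_lt_succ (n := m + m)).2 fun i => ?_
    rcases Nat.even_or_odd' (i : ℕ) with ⟨k, hk | hk⟩
    · have := (h ⟨k, by omega⟩ (Set.mem_univ _)).1
      convert this using 2 <;> ext <;> simp [interleave, hk]
    · have := (h ⟨k, by omega⟩ (Set.mem_univ _)).2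
      convert this using 2 <;> ext <;> simp [interleave, hk]; omega

lemma measurableSet_interlacing (m : ℕ) : MeasurableSet
    {p : (Fin (m + 1) → ℝ) × (Fin m → ℝ) | p.2 ∈ interlacingBox p.1} := by
  have : {p : (Fin (m + 1) → ℝ) × (Fin m → ℝ) | p.2 ∈ interlacingBox p.1} =
      ⋂ i : Fin m, {p | p.1 i.castSucc < p.2 i} ∩ {p | p.2 i < p.1 i.succ} := by
    ext p; simp [interlacingBox, Set.mem_pi]
  rw [this]
  refine MeasurableSet.iInter fun i => MeasurableSet.inter ?_ ?_
  · exact measurableSet_lt ((measurable_pi_apply _).comp measurable_fst)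
      ((measurable_pi_apply _).comp measurable_snd)
  · exact measurableSet_lt ((measurable_pi_apply _).comp measurable_snd)
      ((measurable_pi_apply _).comp measurable_fst)

lemma measurableSet_interlacingBox {m : ℕ} (x : Fin (m + 1) → ℝ) :
    MeasurableSet (interlacingBox x) :=
  MeasurableSet.univ_pi fun _ => measurableSet_Ioo

/-- Integration over increasing `2 * m + 1`-tuples splits into the points in even positions and
the interlacing points in odd positions. -/
lemma lintegral_strictMono_interleave {m : ℕ}
    {G : (Fin (m + 1) → ℝ) → (Fin m → ℝ) → ℝ≥0∞} (hG : Measurable (Function.uncurry G)) :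
    ∫⁻ z in {z : Fin (m + (m + 1)) → ℝ | StrictMono z},
      G (fun j => z (interleave m (Sum.inr j))) (fun i => z (interleave m (Sum.inl i))) =
    ∫⁻ x in {x : Fin (m + 1) → ℝ | StrictMono x}, ∫⁻ y in interlacingBox x, G x y := by
  set T : Set ((Fin (m + 1) → ℝ) × (Fin m → ℝ)) := {p | StrictMono p.1} ∩
    {p | p.2 ∈ interlacingBox p.1} with hT
  have hTm : MeasurableSet T :=
    (measurable_fst (measurableSet_strictMono _)).inter (measurableSet_interlacing m)
  have hmp : MeasurePreserving (fun z : Fin (m + (m + 1)) → ℝ =>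
      ((fun j => z (interleave m (Sum.inr j)), fun i => z (interleave m (Sum.inl i))) :
        (Fin (m + 1) → ℝ) × (Fin m → ℝ))) volume volume :=
    Measure.measurePreserving_swap.comp
      ((volume_measurePreserving_sumPiEquivProdPi (fun _ : Fin m ⊕ Fin (m + 1) => ℝ)).comp
        (measurePreserving_comp_equiv (interleave m)))
  have h1 := hmp.setLIntegral_comp_preimage hTm hG
  have h2 : (fun z : Fin (m + (m + 1)) → ℝ =>
      ((fun j => z (interleave m (Sum.inr j)), fun i => z (interleave m (Sum.inl i))) :
        (Fin (m + 1) → ℝ) × (Fin m → ℝ))) ⁻¹' T = {z | StrictMono z} := by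
    ext z
    exact (strictMono_iff_interlacing z).symm
  rw [h2] at h1
  refine h1.trans ?_
  rw [← lintegral_indicator hTm, Measure.volume_eq_prod,
    lintegral_prod _ (hG.indicator hTm).aemeasurable,
    ← lintegral_indicator (measurableSet_strictMono _)]
  refine lintegral_congr fun x => ?_
  by_cases hx : StrictMono x
  · rw [Set.indicator_of_mem (show x ∈ {x | StrictMono x} from hx),
      ← lintegral_indicator (measurableSet_interlacingBox x)]
    refine lintegral_congr fun y => ?_
    by_cases hy : y ∈ interlacingBox x
    · rw [Set.indicator_of_mem hy, Set.indicator_of_mem (show (x, y) ∈ T from ⟨hx, hy⟩)]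
      rfl
    · rw [Set.indicator_of_notMem hy, Set.indicator_of_notMem fun h => hy h.2]
  · rw [Set.indicator_of_notMem (show x ∉ {x | StrictMono x} from hx)]
    have : ∀ y, T.indicator (Function.uncurry G) (x, y) = 0 := fun y =>
      Set.indicator_of_notMem (fun h => hx h.1) _
    simp [this]

/-! ### Integrating out the interlacing points -/

lemma diffProd_eq_sum {m : ℕ} (y : Fin m → ℝ) :
    diffProd y = ∑ α : Perm (Fin m), ((Perm.sign α : ℤ) : ℝ) * ∏ i, y i ^ (α i : ℕ) := by
  rw [diffProd_eq_det, ← Matrix.det_transpose, Matrix.det_apply']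
  rfl

lemma strictMono_of_mem_interlacingBox {m : ℕ} {x : Fin (m + 1) → ℝ} (hx : StrictMono x)
    {y : Fin m → ℝ} (hy : y ∈ interlacingBox x) : StrictMono y := by
  intro i j hij
  calc y i < x i.succ := (hy i trivial).2
    _ ≤ x j.castSucc := hx.monotone (by rw [Fin.le_def]; simpa using hij)
    _ < y j := (hy j trivial).1

/-- The interlacing points are integrated out one by one in each term of the Leibniz expansion of
`diffProd y`, which gives a determinant of moments over the gaps of `x`. -/
lemma lintegral_interlacingBox {m : ℕ} {f : ℝ → ℝ} (hf : ∀ t, 0 ≤ f t) {x : Fin (m + 1) → ℝ}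
    (hx : StrictMono x) (hint : ∀ (i : Fin m) (j : ℕ),
      IntegrableOn (fun t => f t * t ^ j) (Ioo (x i.castSucc) (x i.succ))) :
    0 ≤ (Matrix.of fun i j : Fin m =>
      ∫ t in (x i.castSucc)..(x i.succ), f t * t ^ (j : ℕ)).det ∧
    ∫⁻ y in interlacingBox x, ENNReal.ofReal ((∏ i, f (y i)) * diffProd y) =
      ENNReal.ofReal (Matrix.of fun i j : Fin m =>
        ∫ t in (x i.castSucc)..(x i.succ), f t * t ^ (j : ℕ)).det := by
  have hr : (volume : Measure (Fin m → ℝ)).restrict (interlacingBox x) =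
      Measure.pi fun i => volume.restrict (Ioo (x i.castSucc) (x i.succ)) := by
    rw [interlacingBox, volume_pi, Measure.restrict_pi_pi]
  have hexp : ∀ y : Fin m → ℝ, (∏ i, f (y i)) * diffProd y =
      ∑ α : Perm (Fin m), ((Perm.sign α : ℤ) : ℝ) * ∏ i, (f (y i) * y i ^ (α i : ℕ)) := by
    intro y
    rw [diffProd_eq_sum, Finset.mul_sum]
    refine Finset.sum_congr rfl fun α _ => ?_
    rw [Finset.prod_mul_distrib]; ring
  have hterm : ∀ α : Perm (Fin m), Integrable
      (fun y : Fin m → ℝ => ((Perm.sign α : ℤ) : ℝ) * ∏ i, (f (y i) * y i ^ (α i : ℕ)))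
      (volume.restrict (interlacingBox x)) := by
    intro α
    rw [hr]
    exact (Integrable.fintype_prod (f := fun i t => f t * t ^ (α i : ℕ))
      fun i => hint i (α i)).const_mul _
  have hI : Integrable (fun y : Fin m → ℝ => (∏ i, f (y i)) * diffProd y)
      (volume.restrict (interlacingBox x)) := by
    simp_rw [hexp]
    exact integrable_finsetSum _ fun α _ => hterm α
  have hval : ∫ y in interlacingBox x, (∏ i, f (y i)) * diffProd y = (Matrix.of fun i j : Fin m =>
        ∫ t in (x i.castSucc)..(x i.succ), f t * t ^ (j : ℕ)).det := by
    simp_rw [hexp]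
    rw [integral_finsetSum _ fun α _ => hterm α, ← Matrix.det_transpose, Matrix.det_apply']
    refine Finset.sum_congr rfl fun α _ => ?_
    rw [integral_const_mul, hr, integral_fintype_prod_eq_prod (fun i t => f t * t ^ (α i : ℕ))]
    congr 1
    refine Finset.prod_congr rfl fun i _ => ?_
    simp only [Matrix.transpose_apply, Matrix.of_apply]
    rw [intervalIntegral.integral_of_le (hx Fin.castSucc_lt_succ).le,
      integral_Ioc_eq_integral_Ioo]
  have hpos : 0 ≤ᵐ[volume.restrict (interlacingBox x)]
      fun y : Fin m → ℝ => (∏ i, f (y i)) * diffProd y := by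
    filter_upwards [ae_restrict_mem (measurableSet_interlacingBox x)] with y hy
    exact mul_nonneg (Finset.prod_nonneg fun i _ => hf _)
      (diffProd_pos (strictMono_of_mem_interlacingBox hx hy)).le
  rw [← hval]
  exact ⟨integral_nonneg_of_ae hpos, (ofReal_integral_eq_lintegral_ofReal hI hpos).symm⟩

/-- The row `(1, F_0 t, …, F_{m-1} t)`, where `F_j` is the primitive of `s ↦ f s * s ^ j` that
vanishes at `x₀`. -/
noncomputable def primitiveRow (f : ℝ → ℝ) (x₀ : ℝ) (m : ℕ) (t : ℝ) : Fin (m + 1) → ℝ :=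
  Fin.cons 1 fun j : Fin m => ∫ s in x₀..t, f s * s ^ (j : ℕ)

/-- The determinant whose rows are the values of `primitiveRow` at the points of `x`. -/
noncomputable def primitiveDet (f : ℝ → ℝ) (x₀ : ℝ) {m : ℕ} (x : Fin (m + 1) → ℝ) : ℝ :=
  (Matrix.of fun i => primitiveRow f x₀ m (x i)).det

/-- Subtracting consecutive rows turns the determinant of primitives into one of increments. -/
lemma primitiveDet_eq {f : ℝ → ℝ} {x₀ : ℝ} {m : ℕ} {x : Fin (m + 1) → ℝ}
    (hint : ∀ (i : Fin (m + 1)) (j : ℕ),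
      IntervalIntegrable (fun s => f s * s ^ j) volume x₀ (x i)) :
    primitiveDet f x₀ x = (Matrix.of fun i j : Fin m =>
      ∫ t in (x i.castSucc)..(x i.succ), f t * t ^ (j : ℕ)).det := by
  set B : Matrix (Fin (m + 1)) (Fin (m + 1)) ℝ := Matrix.of (Fin.cons (primitiveRow f x₀ m (x 0))
    fun i : Fin m => Fin.cons 0 fun j : Fin m =>
      ∫ t in (x i.castSucc)..(x i.succ), f t * t ^ (j : ℕ)) with hB
  have h : primitiveDet f x₀ x = B.det := by
    refine Matrix.det_eq_of_forall_row_eq_smul_add_pred (fun _ => 1) (fun j => rfl) fun i j => ?_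
    refine Fin.cases ?_ (fun j => ?_) j
    · simp [hB, primitiveRow]
    · simp only [hB, primitiveRow, Matrix.of_apply, Fin.cons_succ, one_mul]
      rw [← intervalIntegral.integral_add_adjacent_intervals (hint i.castSucc j)
        ((hint i.castSucc j).symm.trans (hint i.succ j))]
      ring
  rw [h, Matrix.det_succ_column_zero, Fin.sum_univ_succ, Finset.sum_eq_zero]
  · simp only [hB, primitiveRow]
    simp
    rfl
  · intro i _
    simp [hB]

lemma primitiveDet_perm (f : ℝ → ℝ) (x₀ : ℝ) {m : ℕ} (x : Fin (m + 1) → ℝ)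
    (σ : Perm (Fin (m + 1))) :
    primitiveDet f x₀ (fun i => x (σ i)) = ((Perm.sign σ : ℤ) : ℝ) * primitiveDet f x₀ x :=
  Matrix.det_permute σ (Matrix.of fun i => primitiveRow f x₀ m (x i))

lemma diffProd_perm {n : ℕ} (x : Fin n → ℝ) (σ : Perm (Fin n)) :
    diffProd (fun i => x (σ i)) = ((Perm.sign σ : ℤ) : ℝ) * diffProd x := by
  rw [diffProd_eq_det, diffProd_eq_det]
  exact Matrix.det_permute σ (Matrix.vandermonde x)

lemma continuous_diffProd {n : ℕ} : Continuous (diffProd : (Fin n → ℝ) → ℝ) := by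
  unfold diffProd
  fun_prop

lemma abs_diffProd_perm {n : ℕ} (x : Fin n → ℝ) (σ : Perm (Fin n)) :
    |diffProd (fun i => x (σ i))| = |diffProd x| := by
  rw [diffProd_perm, abs_mul]
  rcases Int.units_eq_one_or (Perm.sign σ) with h | h <;> simp [h]

lemma ae_forall_eval {n : ℕ} {p : ℝ → Prop} (h : ∀ᵐ t, p t) :
    ∀ᵐ x : Fin n → ℝ, ∀ i, p (x i) := by
  rw [ae_all_iff]
  intro i
  exact (Measure.quasiMeasurePreserving_eval (fun _ : Fin n => (volume : Measure ℝ)) i).ae h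

lemma IsEnsemble.exists_density_measurable {β n : ℕ} {g : ℝ → ℝ} {ν : Measure (Fin n → ℝ)}
    (h : IsEnsemble β n g ν) : ∃ (g' : ℝ → ℝ) (c : ℝ), Measurable g' ∧ g =ᵐ[volume] g' ∧
      (∀ᵐ x : Fin n → ℝ, 0 ≤ c * ((∏ i, g' (x i)) * |diffProd x| ^ β)) ∧
      ν = (volume : Measure (Fin n → ℝ)).withDensity
        (fun x => ENNReal.ofReal (c * ((∏ i, g' (x i)) * |diffProd x| ^ β))) := by
  obtain ⟨c, h1, h2⟩ := h.exists_density
  refine ⟨h.aemeasurable_weight.mk g, c, h.aemeasurable_weight.measurable_mk,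
    h.aemeasurable_weight.ae_eq_mk, ?_, ?_⟩
  · filter_upwards [h1, ae_forall_eval h.aemeasurable_weight.ae_eq_mk] with x hx hg
    simpa only [← hg] using hx
  · refine h2.trans (withDensity_congr_ae ?_)
    filter_upwards [ae_forall_eval h.aemeasurable_weight.ae_eq_mk] with x hg
    simp only [← hg]

/-- The density is nonnegative almost everywhere, so the weight may be replaced by its absolute
value. -/
lemma IsEnsemble.exists_density_abs {n : ℕ} {f : ℝ → ℝ} {μ : Measure (Fin n → ℝ)}
    (h : IsEnsemble 1 n f μ) : ∃ c : ℝ, 0 ≤ c ∧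
      μ = (volume : Measure (Fin n → ℝ)).withDensity
        (fun x => ENNReal.ofReal (c * ((∏ i, |f (x i)|) * |diffProd x|))) := by
  obtain ⟨c, h1, h2⟩ := h.exists_density
  refine ⟨|c|, abs_nonneg c, ?_⟩
  rw [h2]
  refine withDensity_congr_ae ?_
  filter_upwards [h1] with x hx
  rw [← abs_of_nonneg hx, abs_mul, abs_mul, Finset.abs_prod, pow_one, abs_abs]

/-! ### The functional equation for the two weights -/

lemma measurable_diffProd {n : ℕ} : Measurable (diffProd : (Fin n → ℝ) → ℝ) :=
  continuous_diffProd.measurable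

lemma measurable_prod_comp {n : ℕ} {f : ℝ → ℝ} (hf : Measurable f) :
    Measurable fun x : Fin n → ℝ => ∏ i, f (x i) :=
  Finset.measurable_prod _ fun i _ => hf.comp (measurable_pi_apply i)

/-- The density of the odd points of the superposition on ordered tuples: by
`exists_sum_abs_diffProd` it factors into a part in the odd points and an integral over the points
interlacing with them. -/
lemma lintegral_oddLaw_eq {m : ℕ} (hk : m + 1 = (m + (m + 1) + 1) / 2) {f : ℝ → ℝ}
    (hf : Measurable f) (hf0 : ∀ t, 0 ≤ f t) {c₁ c₂ : ℝ} (hc₁ : 0 ≤ c₁) (hc₂ : 0 ≤ c₂) :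
    ∃ K : ℝ, 0 ≤ K ∧ ∀ φ : (Fin (m + 1) → ℝ) → ℝ≥0∞, Measurable φ →
      ∫⁻ x, φ x ∂(oddLaw hk (superpose
        (volume.withDensity fun u : Fin m → ℝ =>
          ENNReal.ofReal (c₁ * ((∏ i, f (u i)) * |diffProd u|)))
        (volume.withDensity fun v : Fin (m + 1) → ℝ =>
          ENNReal.ofReal (c₂ * ((∏ i, f (v i)) * |diffProd v|))))) =
      ∫⁻ x in {x : Fin (m + 1) → ℝ | StrictMono x}, φ (fun i => x (Fin.rev i)) *
        (ENNReal.ofReal (K * ((∏ i, f (x i)) * diffProd x)) *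
          ∫⁻ y in interlacingBox x, ENNReal.ofReal ((∏ i, f (y i)) * diffProd y)) := by
  obtain ⟨K, hK0, hK⟩ := exists_sum_abs_diffProd m
  refine ⟨c₁ * c₂ * K, by positivity, fun φ hφ => ?_⟩
  have hd : ∀ (n : ℕ) (c : ℝ), Measurable fun u : Fin n → ℝ =>
      ENNReal.ofReal (c * ((∏ i, f (u i)) * |diffProd u|)) := fun n c =>
    (((measurable_prod_comp hf).mul measurable_diffProd.abs).const_mul c).ennreal_ofReal
  have hd' : ∀ (n : ℕ) (c : ℝ), Measurable fun u : Fin n → ℝ =>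
      ENNReal.ofReal (c * ((∏ i, f (u i)) * diffProd u)) := fun n c =>
    (((measurable_prod_comp hf).mul measurable_diffProd).const_mul c).ennreal_ofReal
  have hd1 : Measurable fun u : Fin m → ℝ => ENNReal.ofReal ((∏ i, f (u i)) * diffProd u) := by
    simpa using hd' m 1
  have hφr : Measurable fun x : Fin (m + 1) → ℝ => φ (fun i => x (Fin.rev i)) :=
    hφ.comp (measurable_pi_lambda _ fun i => measurable_pi_apply _)
  rw [lintegral_oddLaw_superpose hk (hd m c₁) (hd (m + 1) c₂) hφ]
  have hG : Measurable (Function.uncurry fun (x : Fin (m + 1) → ℝ) (y : Fin m → ℝ) =>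
      φ (fun i => x (Fin.rev i)) * (ENNReal.ofReal (c₁ * c₂ * K * ((∏ i, f (x i)) * diffProd x)) *
        ENNReal.ofReal ((∏ i, f (y i)) * diffProd y))) :=
    (hφr.comp measurable_fst).mul (((hd' _ _).comp measurable_fst).mul (hd1.comp measurable_snd))
  have hs : ∫⁻ x in {x : Fin (m + 1) → ℝ | StrictMono x}, φ (fun i => x (Fin.rev i)) *
        (ENNReal.ofReal (c₁ * c₂ * K * ((∏ i, f (x i)) * diffProd x)) *
          ∫⁻ y in interlacingBox x, ENNReal.ofReal ((∏ i, f (y i)) * diffProd y)) =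
      ∫⁻ x in {x : Fin (m + 1) → ℝ | StrictMono x}, ∫⁻ y in interlacingBox x,
        φ (fun i => x (Fin.rev i)) *
          (ENNReal.ofReal (c₁ * c₂ * K * ((∏ i, f (x i)) * diffProd x)) *
            ENNReal.ofReal ((∏ i, f (y i)) * diffProd y)) := by
    refine lintegral_congr fun x => ?_
    rw [lintegral_const_mul _ (hd1.const_mul _), lintegral_const_mul _ hd1]
  rw [hs, ← lintegral_strictMono_interleave hG]
  refine setLIntegral_congr_fun (measurableSet_strictMono _) fun z hz => ?_
  dsimp only
  congr 1
  have hp : ∀ {n : ℕ} (u : Fin n → ℝ), 0 ≤ ∏ i, f (u i) := fun u =>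
    Finset.prod_nonneg fun i _ => hf0 _
  have hx : 0 ≤ diffProd (fun j => z (interleave m (Sum.inr j))) :=
    (diffProd_pos (hz.comp (strictMono_interleave_inr m))).le
  set P : ℝ := (∏ i, f (z (interleave m (Sum.inl i)))) * ∏ j, f (z (interleave m (Sum.inr j)))
    with hP
  have hprod : ∀ π : Perm (Fin m ⊕ Fin (m + 1)), (∏ i, f (z (interleave m (π (Sum.inl i))))) *
      ∏ j, f (z (interleave m (π (Sum.inr j)))) = P := by
    intro π
    rw [← Fintype.prod_sum_type (fun a => f (z (interleave m (π a)))),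
      Equiv.prod_comp π (fun a => f (z (interleave m a))), Fintype.prod_sum_type]
  have h1 : ∀ π : Perm (Fin m ⊕ Fin (m + 1)),
      ENNReal.ofReal (c₁ * ((∏ i, f (z (interleave m (π (Sum.inl i))))) *
        |diffProd (fun i => z (interleave m (π (Sum.inl i))))|)) *
      ENNReal.ofReal (c₂ * ((∏ j, f (z (interleave m (π (Sum.inr j))))) *
        |diffProd (fun j => z (interleave m (π (Sum.inr j))))|)) =
      ENNReal.ofReal (c₁ * c₂ * P * (|diffProd (fun i => z (interleave m (π (Sum.inl i))))| *
        |diffProd (fun j => z (interleave m (π (Sum.inr j))))|)) := by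
    intro π
    rw [← ENNReal.ofReal_mul (mul_nonneg hc₁ (mul_nonneg (hp _) (abs_nonneg _))), ← hprod π]
    congr 1; ring
  have hP0 : 0 ≤ P := mul_nonneg (hp _) (hp _)
  simp_rw [h1]
  rw [← ENNReal.ofReal_sum_of_nonneg fun π _ => by positivity, ← Finset.mul_sum, hK z hz,
    ← ENNReal.ofReal_mul (mul_nonneg (by positivity) (mul_nonneg (hp _) hx))]
  congr 1
  rw [hP]; ring

/-- Equality of the two laws as an identity between densities. The last clause says that neither
side is almost everywhere zero, because `ν` has total mass one. -/
lemma functional_equation {m : ℕ} (hk : m + 1 = (m + (m + 1) + 1) / 2) {I : Set ℝ}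
    (hI : I.OrdConnected) (hIm : MeasurableSet I) {f g : ℝ → ℝ} (hf : ContinuousOn f I)
    (hf0 : ∀ x, x ∉ I → f x = 0)
    {x₀ : ℝ} (hx₀ : x₀ ∈ I) {μ₁ : Measure (Fin m → ℝ)} {μ₂ ν : Measure (Fin (m + 1) → ℝ)}
    (hμ₁ : IsOE m f μ₁) (hμ₂ : IsOE (m + 1) f μ₂) (hν : IsUE (m + 1) g ν)
    (hodd : oddLaw hk (superpose μ₁ μ₂) = orderedLaw ν) :
    ∃ K c : ℝ, (∀ᵐ x : Fin (m + 1) → ℝ,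
        K * ((∏ i, |f (x i)|) * primitiveDet (fun t => |f t|) x₀ x) =
          c * ((∏ i, g (x i)) * diffProd x)) ∧
      ¬ ∀ᵐ x : Fin (m + 1) → ℝ, c * ((∏ i, g (x i)) * diffProd x) = 0 := by
  classical
  have hfm : Measurable f := by
    have : f = I.piecewise f 0 := by
      funext x
      by_cases hx : x ∈ I
      · simp [hx]
      · simp [hx, hf0 x hx]
    rw [this]
    exact hf.measurable_piecewise continuousOn_const hIm
  obtain ⟨c₁, hc₁, h₁⟩ := hμ₁.exists_density_abs
  obtain ⟨c₂, hc₂, h₂⟩ := hμ₂.exists_density_abs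
  obtain ⟨g', c, hg'm, hgg', hg'0, hν'⟩ := hν.exists_density_measurable
  obtain ⟨K, hK0, hK⟩ := lintegral_oddLaw_eq hk (f := fun t => |f t|) hfm.abs
    (fun t => abs_nonneg _) hc₁ hc₂
  rw [← h₁, ← h₂, hodd] at hK
  set d : (Fin (m + 1) → ℝ) → ℝ≥0∞ := fun x =>
    ENNReal.ofReal (c * ((∏ i, g' (x i)) * |diffProd x| ^ 2)) with hd
  have hdm : Measurable d :=
    (((measurable_prod_comp hg'm).mul (measurable_diffProd.abs.pow_const 2)).const_mul
      c).ennreal_ofReal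
  have hdsymm : ∀ (σ : Perm (Fin (m + 1))) x, d (fun i => x (σ i)) = d x := by
    intro σ x
    simp only [hd]
    rw [abs_diffProd_perm, Equiv.prod_comp σ (fun i => g' (x i))]
  set A : Set (Fin (m + 1) → ℝ) := {x | StrictMono x} with hA
  set J : (Fin (m + 1) → ℝ) → ℝ≥0∞ := fun x =>
    ∫⁻ y in interlacingBox x, ENNReal.ofReal ((∏ i, |f (y i)|) * diffProd y) with hJ
  have hJm : Measurable J := by
    have h1 : Measurable fun y : Fin m → ℝ =>
        ENNReal.ofReal ((∏ i, |f (y i)|) * diffProd y) :=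
      ((measurable_prod_comp hfm.abs).mul measurable_diffProd).ennreal_ofReal
    have h2 : J = fun x => ∫⁻ y, ({p : (Fin (m + 1) → ℝ) × (Fin m → ℝ) |
        p.2 ∈ interlacingBox p.1}.indicator (fun p =>
        ENNReal.ofReal ((∏ i, |f (p.2 i)|) * diffProd p.2))) (x, y) := by
      funext x
      rw [hJ]
      dsimp only
      rw [← lintegral_indicator (measurableSet_interlacingBox x)]
      rfl
    rw [h2]
    exact ((h1.comp measurable_snd).indicator (measurableSet_interlacing m)).lintegral_prod_right'
  set p : (Fin (m + 1) → ℝ) → ℝ≥0∞ := fun x =>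
    ENNReal.ofReal (K * ((∏ i, |f (x i)|) * diffProd x)) * J x with hp
  have hpm : Measurable p :=
    (((measurable_prod_comp hfm.abs).mul measurable_diffProd).const_mul K).ennreal_ofReal.mul hJm
  have hae : p =ᵐ[volume.restrict A] fun x => ((m + 1).factorial : ℝ≥0∞) * d x := by
    refine ae_eq_of_forall_setLIntegral_eq_of_sigmaFinite hpm (hdm.const_mul _) fun s hs _ => ?_
    have hrevm : Measurable fun (x : Fin (m + 1) → ℝ) (i : Fin (m + 1)) => x (Fin.rev i) :=
      measurable_pi_lambda _ fun i => measurable_pi_apply _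
    have hφ : Measurable fun x : Fin (m + 1) → ℝ =>
        s.indicator (fun _ => (1 : ℝ≥0∞)) (fun i => x (Fin.rev i)) :=
      (measurable_const.indicator hs).comp hrevm
    have e1 := hK _ hφ
    rw [hν', lintegral_orderedLaw hdm hdsymm hφ] at e1
    simp only [Fin.rev_rev] at e1
    rw [← lintegral_indicator hs, ← lintegral_indicator hs]
    have e2 : ∀ q : (Fin (m + 1) → ℝ) → ℝ≥0∞, (fun x => s.indicator q x) = fun x =>
        s.indicator (fun _ => (1 : ℝ≥0∞)) (fun i => x i) * q x := by
      intro q; funext x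
      by_cases hx : x ∈ s <;> simp [hx]
    rw [e2, e2]
    refine e1.symm.trans ?_
    have hsd : Measurable fun x : Fin (m + 1) → ℝ =>
        s.indicator (fun _ => (1 : ℝ≥0∞)) (fun i => x i) * d x :=
      (measurable_const.indicator hs).mul hdm
    rw [← lintegral_const_mul _ hsd]
    refine lintegral_congr fun x => ?_
    ring
  have hadj : ∀ a ∈ I, ∀ b ∈ I, ∀ j : ℕ,
      IntervalIntegrable (fun s => |f s| * s ^ j) volume a b := by
    intro a ha b hb j
    refine ContinuousOn.intervalIntegrable ?_
    exact ((hf.mono (hI.uIcc_subset ha hb)).abs).mul (by fun_prop)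
  -- the identity on increasingly ordered points
  have hord : ∀ᵐ x : Fin (m + 1) → ℝ, StrictMono x →
      K * ((∏ i, |f (x i)|) * primitiveDet (fun t => |f t|) x₀ x) =
        (m + 1).factorial * c * ((∏ i, g' (x i)) * diffProd x) := by
    filter_upwards [(ae_restrict_iff' (measurableSet_strictMono _)).1 hae, hg'0] with x hx hgx hmono
    have hΔ := diffProd_pos hmono
    have hxe := hx hmono
    have hR : ((m + 1).factorial : ℝ≥0∞) * d x =
        ENNReal.ofReal ((m + 1).factorial * (c * ((∏ i, g' (x i)) * |diffProd x| ^ 2))) := by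
      rw [ENNReal.ofReal_mul (Nat.cast_nonneg _), ENNReal.ofReal_natCast]
    have hRn : 0 ≤ ((m + 1).factorial : ℝ) * (c * ((∏ i, g' (x i)) * |diffProd x| ^ 2)) :=
      mul_nonneg (Nat.cast_nonneg _) hgx
    have hfin : K * ((∏ i, |f (x i)|) * diffProd x) * primitiveDet (fun t => |f t|) x₀ x =
        ((m + 1).factorial : ℝ) * (c * ((∏ i, g' (x i)) * |diffProd x| ^ 2)) := by
      by_cases hxI : ∀ i, x i ∈ I
      · obtain ⟨hD0, hDJ⟩ := lintegral_interlacingBox (f := fun t => |f t|)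
          (fun t => abs_nonneg _) hmono
          (fun i j => ((hadj _ (hxI i.castSucc) _ (hxI i.succ) j).1).mono_set Ioo_subset_Ioc_self)
        rw [← primitiveDet_eq (f := fun t => |f t|) (x₀ := x₀)
          fun i j => hadj _ hx₀ _ (hxI i) j] at hD0 hDJ
        have hLn : 0 ≤ K * ((∏ i, |f (x i)|) * diffProd x) :=
          mul_nonneg hK0 (mul_nonneg (Finset.prod_nonneg fun i _ => abs_nonneg _) hΔ.le)
        rw [hR, hp] at hxe
        dsimp only at hxe
        rw [hJ] at hxe
        dsimp only at hxe
        rw [hDJ, ← ENNReal.ofReal_mul hLn] at hxe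
        exact (ENNReal.ofReal_eq_ofReal_iff (mul_nonneg hLn hD0) hRn).1 hxe
      · -- outside `I` the weight kills both sides
        push Not at hxI
        obtain ⟨i, hi⟩ := hxI
        have h0 : ∏ i, |f (x i)| = 0 :=
          Finset.prod_eq_zero (Finset.mem_univ i) (by rw [hf0 _ hi, abs_zero])
        rw [hR, hp] at hxe
        dsimp only at hxe
        rw [h0, zero_mul, mul_zero, ENNReal.ofReal_zero, zero_mul] at hxe
        rw [h0, zero_mul, mul_zero, zero_mul]
        exact le_antisymm hRn (ENNReal.ofReal_eq_zero.1 hxe.symm)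
    -- one factor of the difference product cancels
    rw [sq_abs] at hfin
    refine mul_right_cancel₀ hΔ.ne' ?_
    linear_combination hfin
  -- both sides are antisymmetric, so the order of the points is irrelevant
  have hall : ∀ᵐ x : Fin (m + 1) → ℝ,
      K * ((∏ i, |f (x i)|) * primitiveDet (fun t => |f t|) x₀ x) =
        (m + 1).factorial * c * ((∏ i, g' (x i)) * diffProd x) := by
    have hperm : ∀ᵐ x : Fin (m + 1) → ℝ, ∀ σ : Perm (Fin (m + 1)),
        StrictMono (fun i => x (σ i)) →
        K * ((∏ i, |f (x (σ i))|) * primitiveDet (fun t => |f t|) x₀ (fun i => x (σ i))) =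
          (m + 1).factorial * c * ((∏ i, g' (x (σ i))) * diffProd fun i => x (σ i)) := by
      rw [ae_all_iff]
      intro σ
      exact (measurePreserving_comp_equiv σ).quasiMeasurePreserving.ae hord
    filter_upwards [hperm, ae_injective (Fin (m + 1))] with x hx hinj
    obtain ⟨σ, hσ⟩ := exists_equiv_strictMono (Equiv.refl _) hinj
    have h := hx σ.symm hσ
    rw [primitiveDet_perm, diffProd_perm, Equiv.prod_comp σ.symm (fun i => |f (x i)|),
      Equiv.prod_comp σ.symm (fun i => g' (x i))] at h
    have hs : ((Perm.sign σ.symm : ℤ) : ℝ) ≠ 0 := by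
      exact_mod_cast (Perm.sign σ.symm).ne_zero
    refine mul_left_cancel₀ hs ?_
    linear_combination h
  have hgae := ae_forall_eval (n := m + 1) hgg'
  refine ⟨K, (m + 1).factorial * c, ?_, fun hz => ?_⟩
  · filter_upwards [hall, hgae] with x hx hgx
    simpa only [hgx] using hx
  · have hν0 : ν = 0 := by
      rw [hν']
      refine (withDensity_congr_ae (g := fun _ => 0) ?_).trans (withDensity_zero)
      filter_upwards [hz, hgae] with x hx hgx
      simp only [hgx] at hx
      have h0 : c * ((∏ i, g' (x i)) * diffProd x) = 0 := by
        rw [mul_assoc] at hx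
        exact (mul_eq_zero.1 hx).resolve_left (Nat.cast_ne_zero.2 (Nat.factorial_ne_zero _))
      have : c * ((∏ i, g' (x i)) * |diffProd x| ^ 2) = 0 := by
        rw [sq_abs]; linear_combination diffProd x * h0
      simp only [hd, this, ENNReal.ofReal_zero]
    have := hν.isProbabilityMeasure
    exact IsProbabilityMeasure.ne_zero ν hν0

end Decimation

namespace Decimation

open Polynomial

/-! ### From the determinant identity to polynomial relations -/

lemma ae_ae_update {m : ℕ} {P : (Fin (m + 1) → ℝ) → Prop} (h : ∀ᵐ x, P x) (i : Fin (m + 1)) :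
    ∀ᵐ x : Fin (m + 1) → ℝ, ∀ᵐ s : ℝ, P (Function.update x i s) := by
  have hmp := volume_preserving_piFinSuccAbove (fun _ : Fin (m + 1) => ℝ) i
  have h1 : ∀ᵐ p : ℝ × (Fin m → ℝ), P ((MeasurableEquiv.piFinSuccAbove (fun _ => ℝ) i).symm p) :=
    hmp.symm.quasiMeasurePreserving.ae h
  have h2 : ∀ᵐ p : (Fin m → ℝ) × ℝ,
      P ((MeasurableEquiv.piFinSuccAbove (fun _ => ℝ) i).symm p.swap) :=
    (Measure.measurePreserving_swap (μ := (volume : Measure (Fin m → ℝ)))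
      (ν := (volume : Measure ℝ))).quasiMeasurePreserving.ae h1
  have h3 := Measure.ae_ae_of_ae_prod h2
  have h4 : ∀ᵐ p : ℝ × (Fin m → ℝ), ∀ᵐ s : ℝ,
      P ((MeasurableEquiv.piFinSuccAbove (fun _ => ℝ) i).symm (s, p.2)) :=
    Measure.quasiMeasurePreserving_snd.ae h3
  filter_upwards [hmp.quasiMeasurePreserving.ae h4] with x hx
  filter_upwards [hx] with s hs
  convert hs using 1
  simp [MeasurableEquiv.piFinSuccAbove, Fin.insertNthEquiv, Fin.insertNth_removeNth]

lemma prod_comp_update {n : ℕ} (g : ℝ → ℝ) (t : Fin n → ℝ) (i : Fin n) (s : ℝ) :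
    (∏ k, g (Function.update t i s k)) * g (t i) = g s * ∏ k, g (t k) := by
  rw [← Finset.mul_prod_erase _ _ (Finset.mem_univ i),
    ← Finset.mul_prod_erase Finset.univ (fun k => g (t k)) (Finset.mem_univ i),
    Finset.prod_congr rfl fun k hk => by
      rw [Function.update_of_ne (Finset.ne_of_mem_erase hk)]]
  simp only [Function.update_self]
  ring

/-- Cramer's rule, for the coordinates of `b` in the basis of rows of `M`. -/
lemma det_updateRow_div {n : ℕ} (M : Matrix (Fin n) (Fin n) ℝ) (hM : M.det ≠ 0)
    (b : Fin n → ℝ) (i : Fin n) :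
    (M.updateRow i b).det / M.det = Matrix.vecMul b M⁻¹ i := by
  have h1 : Matrix.vecMul (fun i => (M.updateRow i b).det / M.det) M = b := by
    funext j
    have := congrFun (Matrix.mulVec_cramer M.transpose b) j
    rw [Matrix.det_transpose] at this
    simp only [Matrix.mulVec, dotProduct, Matrix.transpose_apply, Matrix.cramer_transpose_apply,
      Pi.smul_apply, smul_eq_mul] at this
    simp only [Matrix.vecMul, dotProduct]
    calc _ = (∑ i, M i j * (M.updateRow i b).det) / M.det := by
            rw [Finset.sum_div]; exact Finset.sum_congr rfl fun i _ => by ring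
      _ = b j := by rw [this]; field_simp
  have h2 := congrArg (fun v => Matrix.vecMul v M⁻¹) h1
  simp only [Matrix.vecMul_vecMul, Matrix.mul_nonsing_inv _ (isUnit_iff_ne_zero.2 hM),
    Matrix.vecMul_one] at h2
  exact congrFun h2 i

lemma primitiveDet_update (f : ℝ → ℝ) (x₀ : ℝ) {m : ℕ} (t : Fin (m + 1) → ℝ) (i : Fin (m + 1))
    (s : ℝ) : primitiveDet f x₀ (Function.update t i s) =
      ((Matrix.of fun i => primitiveRow f x₀ m (t i)).updateRow i (primitiveRow f x₀ m s)).det := by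
  rw [primitiveDet]
  congr 1
  ext k j
  by_cases hk : k = i
  · subst hk; simp
  · simp [hk]

lemma diffProd_update {n : ℕ} (t : Fin n → ℝ) (i : Fin n)
    (s : ℝ) : diffProd (Function.update t i s) =
      ((Matrix.vandermonde t).updateRow i fun k => s ^ (k : ℕ)).det := by
  rw [diffProd_eq_det]
  congr 1
  ext k j
  by_cases hk : k = i
  · subst hk; simp [Matrix.vandermonde_apply]
  · simp [hk, Matrix.vandermonde_apply]

/-- If a determinant of primitives and a Vandermonde determinant agree up to weights `F` and `g`
in each variable, then moving one point of a generic configuration and applying Cramer's rule to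
both determinants shows that `F • (1, F_0, …, F_{m-1})` and `g • (1, s, …, s ^ m)` are related by a
constant matrix. Recorded are the first column of this relation (with the polynomial `p`) and its
inverse (with the coefficients `B`). -/
lemma exists_polynomial_relation {m : ℕ} {F g : ℝ → ℝ} {x₀ K c : ℝ}
    (h : ∀ᵐ x : Fin (m + 1) → ℝ, K * ((∏ i, F (x i)) * primitiveDet F x₀ x) =
      c * ((∏ i, g (x i)) * diffProd x))
    (hne : ¬ ∀ᵐ x : Fin (m + 1) → ℝ, c * ((∏ i, g (x i)) * diffProd x) = 0) :
    ∃ (p : ℝ[X]) (B : Fin (m + 1) → Fin (m + 1) → ℝ), (∃ s, F s ≠ 0) ∧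
      (∀ᵐ s, F s = 0 → g s = 0) ∧ (∀ᵐ s, F s = g s * p.eval s) ∧
      ∀ k : Fin (m + 1), ∀ᵐ s, g s * s ^ (k : ℕ) = F s * ∑ j, primitiveRow F x₀ m s j * B k j := by
  have hupd : ∀ᵐ x : Fin (m + 1) → ℝ, ∀ i, ∀ᵐ s,
      K * ((∏ k, F (Function.update x i s k)) * primitiveDet F x₀ (Function.update x i s)) =
      c * ((∏ k, g (Function.update x i s k)) * diffProd (Function.update x i s)) :=
    ae_all_iff.2 fun i => ae_ae_update h i
  obtain ⟨t, ht0, ht, htu⟩ := ((Filter.not_eventually.1 hne).and_eventually (h.and hupd)).exists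
  have hc : c ≠ 0 := left_ne_zero_of_mul ht0
  have hgp : ∏ i, g (t i) ≠ 0 := left_ne_zero_of_mul (right_ne_zero_of_mul ht0)
  have hΔ : diffProd t ≠ 0 := right_ne_zero_of_mul (right_ne_zero_of_mul ht0)
  have hK : K ≠ 0 := left_ne_zero_of_mul (ht ▸ ht0)
  have hFp : ∏ i, F (t i) ≠ 0 := left_ne_zero_of_mul (right_ne_zero_of_mul (ht ▸ ht0))
  have hD : primitiveDet F x₀ t ≠ 0 := right_ne_zero_of_mul (right_ne_zero_of_mul (ht ▸ ht0))
  have hg : ∀ i, g (t i) ≠ 0 := fun i => Finset.prod_ne_zero_iff.1 hgp i (Finset.mem_univ i)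
  have hF : ∀ i, F (t i) ≠ 0 := fun i => Finset.prod_ne_zero_iff.1 hFp i (Finset.mem_univ i)
  set M : Matrix (Fin (m + 1)) (Fin (m + 1)) ℝ :=
    Matrix.of fun i => primitiveRow F x₀ m (t i) with hM
  have hMdet : M.det = primitiveDet F x₀ t := rfl
  have hVdet : (Matrix.vandermonde t).det = diffProd t := (diffProd_eq_det t).symm
  set a : Fin (m + 1) → ℝ := fun i => g (t i) / F (t i) with ha
  have ha0 : ∀ i, a i ≠ 0 := fun i => div_ne_zero (hg i) (hF i)
  -- the identity with one coordinate moved, divided by the identity at `t`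
  have hrel : ∀ᵐ s, ∀ i, F s * (a i * Matrix.vecMul (primitiveRow F x₀ m s) M⁻¹ i) =
      g s * Matrix.vecMul (fun k : Fin (m + 1) => s ^ (k : ℕ)) (Matrix.vandermonde t)⁻¹ i := by
    rw [ae_all_iff]
    intro i
    filter_upwards [htu i] with s hs
    rw [← det_updateRow_div _ (hMdet ▸ hD), ← det_updateRow_div _ (hVdet ▸ hΔ), hMdet, hVdet,
      ← primitiveDet_update, ← diffProd_update, ha]
    have e1 := prod_comp_update F t i s
    have e2 := prod_comp_update g t i s
    have hFi := hF i
    dsimp only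
    set D' := primitiveDet F x₀ (Function.update t i s)
    set Δ' := diffProd (Function.update t i s)
    have hmain : F s * (g (t i) * D' * diffProd t) =
        g s * (Δ' * F (t i) * primitiveDet F x₀ t) := by
      refine mul_left_cancel₀ (mul_ne_zero (mul_ne_zero hK hFp) (mul_ne_zero hc hgp)) ?_
      calc _ = (K * ((F s * ∏ k, F (t k)) * D')) * g (t i) *
            (c * ((∏ k, g (t k)) * diffProd t)) := by ring
        _ = (K * ((∏ k, F (Function.update t i s k)) * D')) * (F (t i) * g (t i)) *
            (c * ((∏ k, g (t k)) * diffProd t)) := by rw [← e1]; ring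
        _ = (c * (((∏ k, g (Function.update t i s k)) * g (t i)) * Δ')) * F (t i) *
            (K * ((∏ k, F (t k)) * primitiveDet F x₀ t)) := by rw [hs, ht]; ring
        _ = _ := by rw [e2]; ring
    field_simp
    linear_combination hmain
  have hMu : IsUnit M.det := isUnit_iff_ne_zero.2 (hMdet ▸ hD)
  have hVu : IsUnit (Matrix.vandermonde t).det := isUnit_iff_ne_zero.2 (hVdet ▸ hΔ)
  refine ⟨∑ k : Fin (m + 1), C (∑ i, (Matrix.vandermonde t)⁻¹ k i * (a i)⁻¹) * X ^ (k : ℕ),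
    fun k j => ∑ i, M⁻¹ j i * (a i * t i ^ (k : ℕ)), ⟨t 0, hF 0⟩, ?_, ?_, fun k => ?_⟩
  · -- away from the nodes, the moved difference product does not vanish
    have hnode : ∀ᵐ s : ℝ, ∀ i, s ≠ t i := by
      rw [ae_all_iff]; intro i
      exact Measure.ae_ne volume (t i)
    filter_upwards [hrel, hnode] with s hs hst hFs
    by_contra hgs
    have hz : Matrix.vecMul (fun k : Fin (m + 1) => s ^ (k : ℕ)) (Matrix.vandermonde t)⁻¹ = 0 := by
      funext i
      have := hs i
      rw [hFs, zero_mul] at this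
      exact (mul_eq_zero.1 this.symm).resolve_left hgs
    have hz2 := congrArg (fun v => Matrix.vecMul v (Matrix.vandermonde t)) hz
    simp only [Matrix.vecMul_vecMul, Matrix.nonsing_inv_mul _ hVu, Matrix.vecMul_one,
      Matrix.zero_vecMul] at hz2
    simpa using congrFun hz2 0
  · filter_upwards [hrel] with s hs
    have h0 : ∑ i, Matrix.vecMul (primitiveRow F x₀ m s) M⁻¹ i * M i 0 = 1 := by
      change Matrix.vecMul (Matrix.vecMul (primitiveRow F x₀ m s) M⁻¹) M 0 = 1
      rw [Matrix.vecMul_vecMul, Matrix.nonsing_inv_mul _ hMu, Matrix.vecMul_one]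
      simp [primitiveRow]
    have hM0 : ∀ i, M i 0 = 1 := fun i => by simp [hM, primitiveRow]
    calc F s = ∑ i, (F s * (a i * Matrix.vecMul (primitiveRow F x₀ m s) M⁻¹ i)) * (a i)⁻¹ := by
          conv_lhs => rw [← mul_one (F s), ← h0, Finset.mul_sum]
          refine Finset.sum_congr rfl fun i _ => ?_
          rw [hM0]
          field_simp [ha0 i]
      _ = ∑ i, g s * Matrix.vecMul (fun k : Fin (m + 1) => s ^ (k : ℕ))
            (Matrix.vandermonde t)⁻¹ i * (a i)⁻¹ :=
          Finset.sum_congr rfl fun i _ => by rw [hs i]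
      _ = _ := by
          simp only [eval_finsetSum, eval_mul, eval_C, eval_pow, eval_X, Matrix.vecMul, dotProduct,
            Finset.mul_sum, Finset.sum_mul]
          rw [Finset.sum_comm]
          exact Finset.sum_congr rfl fun i _ => Finset.sum_congr rfl fun j _ => by ring
  · filter_upwards [hrel] with s hs
    have h0 : ∑ i, Matrix.vecMul (fun k : Fin (m + 1) => s ^ (k : ℕ)) (Matrix.vandermonde t)⁻¹ i *
        t i ^ (k : ℕ) = s ^ (k : ℕ) := by
      change Matrix.vecMul (Matrix.vecMul (fun k : Fin (m + 1) => s ^ (k : ℕ))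
        (Matrix.vandermonde t)⁻¹) (Matrix.vandermonde t) k = _
      rw [Matrix.vecMul_vecMul, Matrix.nonsing_inv_mul _ hVu, Matrix.vecMul_one]
    calc g s * s ^ (k : ℕ) = ∑ i, (g s * Matrix.vecMul (fun k : Fin (m + 1) => s ^ (k : ℕ))
            (Matrix.vandermonde t)⁻¹ i) * t i ^ (k : ℕ) := by
          rw [← h0, Finset.mul_sum]
          exact Finset.sum_congr rfl fun i _ => by ring
      _ = ∑ i, (F s * (a i * Matrix.vecMul (primitiveRow F x₀ m s) M⁻¹ i)) * t i ^ (k : ℕ) :=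
          Finset.sum_congr rfl fun i _ => by rw [hs i]
      _ = _ := by
          simp only [Matrix.vecMul, dotProduct, Finset.mul_sum, Finset.sum_mul]
          rw [Finset.sum_comm]
          exact Finset.sum_congr rfl fun i _ => Finset.sum_congr rfl fun j _ => by ring

lemma eq_C_mul_pow_of_derivative_mul {β : ℝ} {σ : ℝ[X]} (hσ0 : σ ≠ 0) (hσ : derivative σ = C β) :
    ∀ (m : ℕ) (p : ℝ[X]), derivative p * σ = C (m * β) * p → ∃ κ : ℝ, p = C κ * σ ^ m := by
  intro m
  induction m with
  | zero =>
    intro p hp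
    have h1 : derivative p = 0 := by
      have : derivative p * σ = 0 := by simpa using hp
      exact (mul_eq_zero.1 this).resolve_right hσ0
    refine ⟨p.coeff 0, ?_⟩
    simpa using eq_C_of_natDegree_eq_zero (derivative_eq_zero.1 h1)
  | succ m ih =>
    intro p hp
    by_cases hβ : β = 0
    · have h1 : derivative p = 0 := by
        have : derivative p * σ = 0 := by simpa [hβ] using hp
        exact (mul_eq_zero.1 this).resolve_right hσ0
      have h2 : σ = C (σ.coeff 0) := eq_C_of_natDegree_eq_zero
        (derivative_eq_zero.1 (by simpa [hβ] using hσ))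
      have h3 : σ.coeff 0 ≠ 0 := fun h => hσ0 (by rw [h2, h, C_0])
      refine ⟨p.coeff 0 / σ.coeff 0 ^ (m + 1), ?_⟩
      conv_lhs => rw [eq_C_of_natDegree_eq_zero (derivative_eq_zero.1 h1)]
      rw [h2, ← C_pow, ← C_mul]
      congr 1
      simp only [coeff_C_zero]
      field_simp
    · have hd := congrArg derivative hp
      simp only [derivative_mul, derivative_C, zero_mul, zero_add, hσ] at hd
      obtain ⟨κ, hκ⟩ := ih (derivative p) (by
        have : derivative (derivative p) * σ =
          C (((m + 1 : ℕ) : ℝ) * β) * derivative p - derivative p * C β := by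
            linear_combination hd
        rw [this]
        simp only [Nat.cast_add, Nat.cast_one, C_mul, C_add, C_1]
        ring)
      refine ⟨κ / ((m + 1 : ℕ) * β), ?_⟩
      have hmβ : ((m + 1 : ℕ) : ℝ) * β ≠ 0 := mul_ne_zero (by positivity) hβ
      rw [hκ] at hp
      refine mul_left_cancel₀ (C_ne_zero.2 hmβ) ?_
      rw [← hp, ← mul_assoc, ← C_mul, mul_div_cancel₀ _ hmβ]
      ring

/-! ### Solving the polynomial relations -/

lemma polynomial_eq_of_eval_eq_on_isOpen {U : Set ℝ} (hU : IsOpen U) (hne : U.Nonempty) {p q : ℝ[X]}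
    (h : ∀ s ∈ U, p.eval s = q.eval s) : p = q := by
  obtain ⟨x, hx⟩ := hne
  exact eq_of_infinite_eval_eq p q ((infinite_of_mem_nhds x (hU.mem_nhds hx)).mono h)

/-- Only the bound on the degrees of the last two polynomials `q k` is used: the coefficients of
degree above `m` give two linear relations between the coefficients of `σ` and `q₀`. -/
lemma affine_of_coeff {m : ℕ} {σ q₀ : ℝ[X]} {q : Fin (m + 2) → ℝ[X]}
    (hdeg : ∀ k, (q k).degree < (m + 1 : ℕ)) (hq₀ : q 0 = q₀)
    (hq : ∀ k : Fin (m + 1), q k.succ =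
      C (((k : ℕ) : ℝ) + 1) * X ^ (k : ℕ) * σ + X ^ ((k : ℕ) + 1) * q₀) :
    ∃ α β : ℝ, σ = C α + C β * X ∧ q₀ = C (-((m + 1 : ℕ) * β)) := by
  have h1 : ∀ i, ((m : ℝ) + 1) * σ.coeff (i + 1) + q₀.coeff i = 0 := by
    intro i
    have h := coeff_eq_zero_of_degree_lt (p := q (Fin.last m).succ) (n := i + (m + 1))
      ((hdeg _).trans_le (by exact_mod_cast Nat.le_add_left _ _))
    rw [hq, coeff_add, mul_assoc, coeff_C_mul, mul_comm (X ^ _) σ, mul_comm (X ^ _) q₀] at h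
    rw [Fin.val_last, coeff_mul_X_pow, show i + (m + 1) = (i + 1) + m by ring,
      coeff_mul_X_pow] at h
    exact h
  have h2 : ∀ i, (m : ℝ) * σ.coeff (i + 2) + q₀.coeff (i + 1) = 0 := by
    intro i
    rcases m with _ | l
    · have := coeff_eq_zero_of_degree_lt (p := q 0) (n := i + 1)
        ((hdeg 0).trans_le (by exact_mod_cast Nat.le_add_left _ _))
      rw [hq₀] at this
      simp [this]
    · have h := coeff_eq_zero_of_degree_lt (p := q (Fin.last l).castSucc.succ) (n := i + (l + 2))
        ((hdeg _).trans_le (by exact_mod_cast Nat.le_add_left _ _))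
      rw [hq, coeff_add, mul_assoc, coeff_C_mul, mul_comm (X ^ _) σ, mul_comm (X ^ _) q₀] at h
      rw [Fin.val_castSucc, Fin.val_last, show i + (l + 2) = (i + 1) + (l + 1) by ring,
        coeff_mul_X_pow, show (i + 1) + (l + 1) = (i + 2) + l by ring, coeff_mul_X_pow] at h
      push_cast
      exact h
  have h3 : ∀ i, σ.coeff (i + 2) = 0 := fun i => by linear_combination h1 (i + 1) - h2 i
  have h4 : ∀ i, q₀.coeff (i + 1) = 0 := fun i => by
    have := h2 i
    rwa [h3, mul_zero, zero_add] at this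
  refine ⟨σ.coeff 0, σ.coeff 1, ?_, ?_⟩
  · ext i
    rcases i with _ | _ | i
    · simp
    · simp
    · rw [h3]; simp
  · ext i
    rcases i with _ | i
    · have := h1 0
      simp only [coeff_C_zero]
      push_cast
      linear_combination this
    · rw [h4, coeff_C_succ]

/-- If every monomial of degree at most `m + 1` is `p` times a combination of the functions
`1, F_0, …, F_m`, where `F_j` is a primitive of `F s * s ^ j`, then `p` is a multiple of a power of
an affine function, and so is `1 / F`. Nothing is assumed about the connectedness of `U`; the
affine function is the same on all its components. -/
lemma rational_form {m : ℕ} {U : Set ℝ} (hU : IsOpen U) (hne : U.Nonempty) {F : ℝ → ℝ}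
    (hF : ∀ s ∈ U, F s ≠ 0) {φ : ℝ → Fin (m + 2) → ℝ} (hφ0 : ∀ s, φ s 0 = 1)
    (hφ : ∀ s ∈ U, ∀ j : Fin (m + 1), HasDerivAt (fun s => φ s j.succ) (F s * s ^ (j : ℕ)) s)
    {p : ℝ[X]} {B : Fin (m + 2) → Fin (m + 2) → ℝ}
    (hrel : ∀ k : Fin (m + 2), ∀ s ∈ U, s ^ (k : ℕ) = p.eval s * ∑ j, φ s j * B k j) :
    ∃ α β κ : ℝ, ∀ s ∈ U, p.eval s = κ * (α + β * s) ^ (m + 1) ∧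
      κ * (α + β * s) ^ (m + 2) * F s = 1 := by
  have hp : ∀ s ∈ U, p.eval s ≠ 0 := by
    intro s hs h
    have := hrel 0 s hs
    simp [h] at this
  set q : Fin (m + 2) → ℝ[X] := fun k => ∑ j : Fin (m + 1), C (B k j.succ) * X ^ (j : ℕ) with hq
  have hdeg : ∀ k, (q k).degree < (m + 1 : ℕ) := by
    intro k
    refine (degree_sum_le _ _).trans_lt ((Finset.sup_lt_iff (by simp)).2 fun j _ => ?_)
    exact (degree_C_mul_X_pow_le _ _).trans_lt (by exact_mod_cast j.isLt)
  -- differentiating the relations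
  have hder : ∀ k : Fin (m + 2), ∀ s ∈ U, ((k : ℕ) : ℝ) * s ^ ((k : ℕ) - 1) * p.eval s =
      p.derivative.eval s * s ^ (k : ℕ) + p.eval s ^ 2 * F s * (q k).eval s := by
    intro k s hs
    have h1 : HasDerivAt (fun s => ∑ j, φ s j * B k j) (F s * (q k).eval s) s := by
      have h2 : HasDerivAt (fun s => ∑ j : Fin (m + 1), φ s j.succ * B k j.succ)
          (∑ j : Fin (m + 1), F s * s ^ (j : ℕ) * B k j.succ) s :=
        HasDerivAt.fun_sum fun j _ => (hφ s hs j).mul_const _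
      have h3 : (fun s => ∑ j, φ s j * B k j) =
          fun s => B k 0 + ∑ j : Fin (m + 1), φ s j.succ * B k j.succ := by
        funext s
        rw [Fin.sum_univ_succ, hφ0, one_mul]
      rw [h3]
      refine (h2.const_add (B k 0)).congr_deriv ?_
      simp only [hq, eval_finsetSum, eval_mul, eval_C, eval_pow, eval_X, Finset.mul_sum]
      exact Finset.sum_congr rfl fun j _ => by ring
    have h4 := (p.hasDerivAt s).mul h1
    have h5 : HasDerivAt (fun s : ℝ => s ^ (k : ℕ)) (((k : ℕ) : ℝ) * s ^ ((k : ℕ) - 1)) s :=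
      hasDerivAt_pow _ _
    have h6 : HasDerivAt (fun s : ℝ => s ^ (k : ℕ)) (p.derivative.eval s * (∑ j, φ s j * B k j) +
        p.eval s * (F s * (q k).eval s)) s :=
      h4.congr_of_eventuallyEq (Filter.eventually_of_mem (hU.mem_nhds hs) fun u hu => hrel k u hu)
    rw [h5.unique h6, hrel k s hs]
    ring
  have hR : ∀ s ∈ U, p.eval s ^ 2 * F s ≠ 0 := fun s hs =>
    mul_ne_zero (pow_ne_zero 2 (hp s hs)) (hF s hs)
  -- with `R = p ^ 2 * F`, the first two relations say `p' = -R * q 0` and `p = R * σ`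
  set σ : ℝ[X] := q 1 - X * q 0 with hσ
  have e0 : ∀ s ∈ U, p.derivative.eval s = -(p.eval s ^ 2 * F s * (q 0).eval s) := by
    intro s hs
    have := hder 0 s hs
    simp at this
    linear_combination -this
  have e1 : ∀ s ∈ U, p.eval s = p.eval s ^ 2 * F s * σ.eval s := by
    intro s hs
    have := hder 1 s hs
    simp at this
    rw [hσ, eval_sub, eval_mul, eval_X]
    linear_combination this + s * e0 s hs
  have hqk : ∀ k : Fin (m + 1), q k.succ =
      C (((k : ℕ) : ℝ) + 1) * X ^ (k : ℕ) * σ + X ^ ((k : ℕ) + 1) * q 0 := by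
    intro k
    refine polynomial_eq_of_eval_eq_on_isOpen hU hne fun s hs => mul_left_cancel₀ (hR s hs) ?_
    have := hder k.succ s hs
    simp only [Fin.val_succ, Nat.cast_add, Nat.cast_one, Nat.add_sub_cancel] at this
    simp only [eval_add, eval_mul, eval_C, eval_pow, eval_X]
    linear_combination -this + ((((k : ℕ) : ℝ) + 1) * s ^ (k : ℕ)) * e1 s hs -
      s ^ ((k : ℕ) + 1) * e0 s hs
  obtain ⟨α, β, hσ', hq0⟩ := affine_of_coeff hdeg rfl hqk
  have hσ0 : σ ≠ 0 := by
    obtain ⟨s, hs⟩ := hne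
    intro h
    have := e1 s hs
    rw [h] at this
    exact hp s hs (by simpa using this)
  obtain ⟨κ, hκ⟩ := eq_C_mul_pow_of_derivative_mul hσ0 (β := β) (by simp [hσ']) (m + 1) p (by
    refine polynomial_eq_of_eval_eq_on_isOpen hU hne fun s hs => ?_
    have h0 : (q 0).eval s = -((m + 1 : ℕ) * β) := by rw [hq0, eval_C]
    rw [eval_mul, eval_mul, eval_C]
    have := e0 s hs
    rw [h0] at this
    linear_combination σ.eval s * this - ((m + 1 : ℕ) : ℝ) * β * e1 s hs)
  have hev : ∀ s, σ.eval s = α + β * s := fun s => by simp [hσ']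
  refine ⟨α, β, κ, fun s hs => ?_⟩
  have hps : p.eval s = κ * (α + β * s) ^ (m + 1) := by
    rw [hκ, eval_mul, eval_C, eval_pow, hev]
  refine ⟨hps, mul_left_cancel₀ (hp s hs) ?_⟩
  have := e1 s hs
  rw [hev] at this
  calc _ = p.eval s * (κ * (α + β * s) ^ (m + 1)) * F s * (α + β * s) := by ring
    _ = p.eval s * 1 := by rw [← hps, mul_one]; linear_combination -this

lemma hasDerivAt_primitiveRow {I : Set ℝ} (hIo : IsOpen I) (hI : I.OrdConnected) {F : ℝ → ℝ}
    (hF : ContinuousOn F I) {x₀ : ℝ} (hx₀ : x₀ ∈ I) {m : ℕ} (j : Fin m) {s : ℝ} (hs : s ∈ I) :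
    HasDerivAt (fun s => primitiveRow F x₀ m s j.succ) (F s * s ^ (j : ℕ)) s := by
  have hc : ContinuousOn (fun s => F s * s ^ (j : ℕ)) I := hF.mul (by fun_prop)
  simp only [primitiveRow, Fin.cons_succ]
  exact intervalIntegral.integral_hasDerivAt_right
    ((hc.mono (hI.uIcc_subset hx₀ hs)).intervalIntegrable)
    (hc.stronglyMeasurableAtFilter hIo s hs) (hc.continuousAt (hIo.mem_nhds hs))

/-- A continuous `F` that is inverse to a continuous `G` wherever it is nonzero cannot tend to `0`,
so its support is closed in `I`. -/
lemma eq_one_of_isPreconnected {I : Set ℝ} (hI : IsPreconnected I) (hIo : IsOpen I) {F G : ℝ → ℝ}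
    (hF : ContinuousOn F I) (hG : ContinuousOn G I) (hne : ∃ s ∈ I, F s ≠ 0)
    (h : ∀ s ∈ I, F s ≠ 0 → G s * F s = 1) : ∀ s ∈ I, G s * F s = 1 := by
  have hUo : IsOpen (I ∩ F ⁻¹' {0}ᶜ) := hF.isOpen_inter_preimage hIo isOpen_compl_singleton
  have hsub := hI.subset_of_closure_inter_subset hUo
    (by obtain ⟨s, hs, hFs⟩ := hne; exact ⟨s, hs, hs, hFs⟩) (by
      rintro x ⟨hx, hxI⟩
      have h1 : ContinuousWithinAt (fun s => G s * F s) (I ∩ F ⁻¹' {0}ᶜ) x :=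
        ((hG.mul hF) x hxI).mono Set.inter_subset_left
      have h2 := h1.mem_closure_image hx
      have h3 : (fun s => G s * F s) '' (I ∩ F ⁻¹' {0}ᶜ) ⊆ {1} := by
        rintro _ ⟨s, ⟨hs, hFs⟩, rfl⟩
        exact h s hs hFs
      have h4 : G x * F x = 1 := by simpa using closure_mono h3 h2
      exact ⟨hxI, fun h0 => by
        rw [Set.mem_singleton_iff] at h0
        rw [h0] at h4; simp at h4⟩)
  intro s hs
  exact h s hs (hsub hs).2

lemma exists_sign {I : Set ℝ} (hI : IsPreconnected I) {f : ℝ → ℝ} (hf : ContinuousOn f I)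
    (hf0 : ∀ x ∈ I, f x ≠ 0) : ∃ ε : ℝ, ε ≠ 0 ∧ ∀ x ∈ I, f x = ε * |f x| := by
  by_cases h : ∃ a ∈ I, f a < 0
  · obtain ⟨a, ha, hfa⟩ := h
    refine ⟨-1, by norm_num, fun x hx => ?_⟩
    have : f x < 0 := by
      by_contra hfx
      obtain ⟨y, hy, hy0⟩ := hI.intermediate_value ha hx hf ⟨hfa.le, not_lt.1 hfx⟩
      exact hf0 y hy hy0
    rw [abs_of_neg this]; ring
  · push Not at h
    exact ⟨1, one_ne_zero, fun x hx => by rw [abs_of_nonneg (h x hx), one_mul]⟩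

lemma IsEnsemble.exists_weight_ne_zero {n : ℕ} {f : ℝ → ℝ} {μ : Measure (Fin (n + 1) → ℝ)}
    (h : IsEnsemble 1 (n + 1) f μ) : ∃ x, f x ≠ 0 := by
  by_contra! hf
  obtain ⟨c, -, h2⟩ := h.exists_density_abs
  have h0 : (fun x : Fin (n + 1) → ℝ =>
      ENNReal.ofReal (c * ((∏ i, |f (x i)|) * |diffProd x|))) = 0 := by
    funext x
    rw [Finset.prod_eq_zero (Finset.mem_univ 0) (by rw [hf, abs_zero])]
    simp
  rw [h0, withDensity_zero] at h2
  have := h.isProbabilityMeasure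
  exact IsProbabilityMeasure.ne_zero μ h2

/-! ### The weights are powers of an affine function -/

lemma affine_form_of_relation {m : ℕ} {I : Set ℝ} (hIo : IsOpen I) (hI : I.OrdConnected)
    {F g : ℝ → ℝ} (hFc : ContinuousOn F I) (hF0 : ∀ x, x ∉ I → F x = 0) {x₀ K c : ℝ} (hx₀ : x₀ ∈ I)
    (h : ∀ᵐ x : Fin (m + 2) → ℝ, K * ((∏ i, F (x i)) * primitiveDet F x₀ x) =
      c * ((∏ i, g (x i)) * diffProd x))
    (hne : ¬ ∀ᵐ x : Fin (m + 2) → ℝ, c * ((∏ i, g (x i)) * diffProd x) = 0) :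
    (∀ᵐ x : ℝ, x ∉ I → g x = 0) ∧ ∃ α β κ : ℝ,
      (∀ x ∈ I, κ * (α + β * x) ^ (m + 2) * F x = 1) ∧
      (∀ᵐ x : ℝ, x ∈ I → g x * (κ * (α + β * x) ^ (m + 1)) = F x) := by
  obtain ⟨p, B, ⟨s₀, hs₀⟩, hg0, hgp, hrel⟩ := exists_polynomial_relation h hne
  have hs₀I : s₀ ∈ I := by
    by_contra h
    exact hs₀ (hF0 _ h)
  set U : Set ℝ := I ∩ F ⁻¹' {0}ᶜ with hU
  have hUo : IsOpen U := hFc.isOpen_inter_preimage hIo isOpen_compl_singleton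
  have hφ : ∀ s ∈ I, ∀ j : Fin (m + 1),
      HasDerivAt (fun s => primitiveRow F x₀ (m + 1) s j.succ) (F s * s ^ (j : ℕ)) s :=
    fun s hs j => hasDerivAt_primitiveRow hIo hI hFc hx₀ j hs
  have hφ0 : ∀ s, primitiveRow F x₀ (m + 1) s 0 = 1 := fun s => rfl
  have hrelU : ∀ k : Fin (m + 2), ∀ s ∈ U, s ^ (k : ℕ) =
      p.eval s * ∑ j, primitiveRow F x₀ (m + 1) s j * B k j := by
    intro k
    have hrow : ∀ j : Fin (m + 2), ContinuousOn (fun s => primitiveRow F x₀ (m + 1) s j) U := by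
      intro j
      refine Fin.cases ?_ (fun j => ?_) j
      · exact continuousOn_const
      · exact fun s hs => (hφ s hs.1 j).continuousAt.continuousWithinAt
    refine Measure.eqOn_open_of_ae_eq (μ := volume) ?_ hUo (by fun_prop)
      (p.continuous.continuousOn.mul (continuousOn_finsetSum _ fun j _ =>
        (hrow j).mul continuousOn_const))
    rw [Filter.EventuallyEq, ae_restrict_iff' hUo.measurableSet]
    filter_upwards [hgp, hrel k] with s e1 e2 hs
    refine mul_left_cancel₀ (show F s ≠ 0 from hs.2) ?_
    calc F s * s ^ (k : ℕ) = (g s * s ^ (k : ℕ)) * p.eval s := by rw [e1]; ring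
      _ = _ := by rw [e2]; ring
  obtain ⟨α, β, κ, hform⟩ := rational_form hUo ⟨s₀, hs₀I, hs₀⟩ (fun s hs => hs.2) hφ0
    (fun s hs => hφ s hs.1) hrelU
  have hall : ∀ s ∈ I, κ * (α + β * s) ^ (m + 2) * F s = 1 :=
    eq_one_of_isPreconnected hI.isPreconnected hIo hFc (by fun_prop) ⟨s₀, hs₀I, hs₀⟩
      fun s hs hFs => (hform s ⟨hs, hFs⟩).2
  refine ⟨?_, α, β, κ, hall, ?_⟩
  · filter_upwards [hg0] with x hx hxI
    exact hx (hF0 x hxI)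
  · filter_upwards [hgp] with x hgx hx
    have hFx : F x ≠ 0 := right_ne_zero_of_mul (hall x hx ▸ one_ne_zero)
    rw [hgx, (hform x ⟨hx, hFx⟩).1]

lemma exists_affine_form {m : ℕ} (hk : m + 2 = (m + 1 + (m + 2) + 1) / 2) {I : Set ℝ}
    (hIo : IsOpen I) (hI : I.OrdConnected) {f g : ℝ → ℝ} (hf : ContinuousOn f I)
    (hf0 : ∀ x, x ∉ I → f x = 0) {μ₁ : Measure (Fin (m + 1) → ℝ)} {μ₂ ν : Measure (Fin (m + 2) → ℝ)}
    (hμ₁ : IsOE (m + 1) f μ₁) (hμ₂ : IsOE (m + 2) f μ₂) (hν : IsUE (m + 2) g ν)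
    (hodd : oddLaw hk (superpose μ₁ μ₂) = orderedLaw ν) :
    (∀ᵐ x : ℝ, x ∉ I → g x = 0) ∧ ∃ α β ε κ : ℝ, ε ≠ 0 ∧ κ ≠ 0 ∧ (α ≠ 0 ∨ β ≠ 0) ∧
      (∀ x ∈ I, α + β * x ≠ 0) ∧
      (∀ x ∈ I, f x = ε / (κ * (α + β * x) ^ (m + 2))) ∧
      (∀ᵐ x : ℝ, x ∈ I → g x = 1 / (κ ^ 2 * (α + β * x) ^ (2 * m + 3))) := by
  obtain ⟨x₀, hx₀⟩ : I.Nonempty := by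
    obtain ⟨x, hx⟩ := hμ₂.exists_weight_ne_zero
    exact ⟨x, by_contra fun h => hx (hf0 x h)⟩
  obtain ⟨K, c, h1, h2⟩ := functional_equation hk hI hIo.measurableSet hf hf0 hx₀ hμ₁ hμ₂ hν hodd
  obtain ⟨hg0, α, β, κ, hall, hg⟩ := affine_form_of_relation (F := fun t => |f t|) hIo hI hf.abs
    (fun x hx => by rw [hf0 x hx, abs_zero]) hx₀ h1 h2
  have hFne : ∀ s ∈ I, |f s| ≠ 0 := fun s hs => right_ne_zero_of_mul (hall s hs ▸ one_ne_zero)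
  have hκ : κ ≠ 0 := left_ne_zero_of_mul (left_ne_zero_of_mul (hall x₀ hx₀ ▸ one_ne_zero))
  have hσ : ∀ s ∈ I, α + β * s ≠ 0 := fun s hs h => by
    have := hall s hs
    rw [h] at this
    simp at this
  obtain ⟨ε, hε, hsign⟩ := exists_sign hI.isPreconnected hf fun x hx => abs_ne_zero.1 (hFne x hx)
  refine ⟨hg0, α, β, ε, κ, hε, hκ, ?_, hσ, fun x hx => ?_, ?_⟩
  · by_contra! h
    exact hσ x₀ hx₀ (by simp [h.1, h.2])
  · have hx1 := hall x hx
    rw [hsign x hx, eq_div_iff (mul_ne_zero hκ (pow_ne_zero _ (hσ x hx)))]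
    linear_combination ε * hx1
  · filter_upwards [hg] with x hgx hx
    have hx1 := hall x hx
    rw [← hgx hx] at hx1
    rw [eq_div_iff (mul_ne_zero (pow_ne_zero 2 hκ) (pow_ne_zero _ (hσ x hx)))]
    linear_combination hx1

end Decimation

theorem mainTheorem6 (n : ℕ) (hn : 2 ≤ n)
    (I : Set ℝ) (hIopen : IsOpen I) (hIconn : I.OrdConnected)
    (f g : ℝ → ℝ) (hf : DifferentiableOn ℝ f I) (hf0 : ∀ x, x ∉ I → f x = 0)
    (μ₁ : Measure (Fin (n - 1) → ℝ)) (μ₂ ν : Measure (Fin n → ℝ))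
    (hμ₁ : Decimation.IsOE (n - 1) f μ₁) (hμ₂ : Decimation.IsOE n f μ₂)
    (hν : Decimation.IsUE n g ν)
    (hodd : Decimation.oddLaw (k := n) (by omega) (Decimation.superpose μ₁ μ₂) =
      Decimation.orderedLaw ν) :
    (∀ᵐ x : ℝ, x ∉ I → g x = 0) ∧
    ((∃ r : ℝ, (r ≠ 0 → 1 / r ∉ I) ∧
        (∃ a : ℝ, a ≠ 0 ∧ ∀ x ∈ I, f x = a * (1 - r * x) ^ (-(n : ℤ))) ∧
        (∃ b : ℝ, b ≠ 0 ∧ ∀ᵐ x : ℝ, x ∈ I → g x = b * (1 - r * x) ^ (-2 * (n : ℤ) + 1))) ∨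
      -- the case in which the parameter is infinite
      ((0 : ℝ) ∉ I ∧
        (∃ a : ℝ, a ≠ 0 ∧ ∀ x ∈ I, f x = a * x ^ (-(n : ℤ))) ∧
        (∃ b : ℝ, b ≠ 0 ∧ ∀ᵐ x : ℝ, x ∈ I → g x = b * x ^ (-2 * (n : ℤ) + 1)))) := by
  obtain ⟨m, rfl⟩ : ∃ m, n = m + 2 := ⟨n - 2, by omega⟩
  obtain ⟨hg0, α, β, ε, κ, hε, hκ, hαβ, hσ, hfx, hgx⟩ :=
    Decimation.exists_affine_form (by omega) hIopen hIconn hf.continuousOn hf0 hμ₁ hμ₂ hν hodd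
  have hexp1 : ∀ y : ℝ, y ^ (-((m + 2 : ℕ) : ℤ)) = (y ^ (m + 2))⁻¹ := fun y => by
    rw [zpow_neg, zpow_natCast]
  have hexp2 : ∀ y : ℝ, y ^ (-2 * ((m + 2 : ℕ) : ℤ) + 1) = (y ^ (2 * m + 3))⁻¹ := fun y => by
    rw [show -2 * ((m + 2 : ℕ) : ℤ) + 1 = -((2 * m + 3 : ℕ) : ℤ) by push_cast; ring, zpow_neg,
      zpow_natCast]
  refine ⟨hg0, ?_⟩
  by_cases hα : α = 0
  · right
    subst hα
    have hβ : β ≠ 0 := by simpa using hαβ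
    refine ⟨fun h => hσ 0 h (by simp), ⟨ε / (κ * β ^ (m + 2)), by positivity, fun x hx => ?_⟩,
      ⟨1 / (κ ^ 2 * β ^ (2 * m + 3)), by positivity, ?_⟩⟩
    · rw [hfx x hx, hexp1, zero_add, mul_pow]
      field_simp
    · filter_upwards [hgx] with x hx hxI
      rw [hx hxI, hexp2, zero_add, mul_pow]
      field_simp
  · left
    have hr : ∀ x, α + β * x = α * (1 - -β / α * x) := fun x => by field_simp; ring
    refine ⟨-β / α, fun hr0 h => ?_, ⟨ε / (κ * α ^ (m + 2)), by positivity, fun x hx => ?_⟩,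
      ⟨1 / (κ ^ 2 * α ^ (2 * m + 3)), by positivity, ?_⟩⟩
    · refine hσ _ h ?_
      rw [hr, mul_one_div_cancel hr0, sub_self, mul_zero]
    · rw [hfx x hx, hexp1, hr, mul_pow]
      field_simp
    · filter_upwards [hgx] with x hx hxI
      rw [hx hxI, hexp2, hr, mul_pow]
      field_simp
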